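/- Let $G$ be a finite connected graph (multiple edges allowed) containing at least one edge. For a metric $\ell : E(G) \to (0,\infty)$ on $G$, let $L(G,\ell)=\sum_{e}\ell(e)$, identify each edge $e$ with an interval of length $\ell(e)$, and let $0=\lambda_0(G,\ell)<\lambda_1(G,\ell)\le\lambda_2(G,\ell)\le\dots$ be the eigenvalues, repeated according to multiplicity, of the problem $-f''=\lambda f$ over each edge, where $f$ is continuous on $G$ and, at each vertex $v$, the derivatives of $f$ at $v$ along the incident edges, taken in the direction away from $v$, sum to zero. Let $\Lambda_1(G)$ be the smallest number such that $\lambda_1(G,\ell)\le \Lambda_1(G)/L(G,\ell)^2$ for all metrics $\ell$ on $G$. Let $m(G)$ and $n(G)$ be the numbers of edges and vertices of $G$, and let $\beta(G)=m(G)-n(G)+1$ be its Betti number. Assume that $G$ has no loops and no pendant vertices (vertices of degree one), and that some set of $n(G)-1$ vertices of $G$ induces a tree. Then \[ \Lambda_1(G)=\bigl(1+\beta(G)\bigr)^2\pi^2 . \] -/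

import Mathlib

open scoped Graph

noncomputable section

namespace QuantumGraph

universe u v

/-! ### Finite multigraphs -/

/-- A multigraph is connected if it has a vertex and any two vertices are joined by a walk. -/
def Connected {α : Type u} {β : Type v} (G : Graph α β) : Prop :=
  V(G).Nonempty ∧ ∀ x ∈ V(G), ∀ y ∈ V(G), Relation.ReflTransGen G.Adj x y

/-- A multigraph contains a cycle if, for some `k ≥ 1`, there are `k` distinct vertices and
`k` distinct edges which form a closed circuit. Here `k = n + 1`, and addition in `Fin (n + 1)` is
cyclic. A loop is a cycle with `k = 1`, and a pair of parallel edges is a cycle with `k = 2`. -/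
def HasCycle {α : Type u} {β : Type v} (G : Graph α β) : Prop :=
  ∃ (n : ℕ) (x : Fin (n + 1) → α) (e : Fin (n + 1) → β),
    Function.Injective x ∧ Function.Injective e ∧ ∀ i, G.IsLink (e i) (x i) (x (i + 1))

/-- A tree is a connected multigraph without cycles. -/
def IsTree {α : Type u} {β : Type v} (G : Graph α β) : Prop :=
  Connected G ∧ ¬ HasCycle G

/-- The degree of a vertex; a loop counts twice. -/
def degree {α : Type u} {β : Type v} (G : Graph α β) (x : α) : ℕ∞ :=
  (G.incidenceSet x).encard + (G.loopSet x).encard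

/-- A pendant vertex is a vertex of degree one. -/
def IsPendant {α : Type u} {β : Type v} (G : Graph α β) (x : α) : Prop :=
  x ∈ V(G) ∧ degree G x = 1

/-- The Betti number `m(G) - n(G) + 1` of a finite connected graph with `m(G)` edges and
`n(G)` vertices. -/
def bettiNumber {α : Type u} {β : Type v} (G : Graph α β) : ℤ :=
  (E(G).ncard : ℤ) - (V(G).ncard : ℤ) + 1

/-! ### Metric graphs

A metric on `G` is a positive function `ℓ : E(G) → ℝ`. The edge `e` is identified with the interval
`[0, ℓ e]`, where the point `0` is the end `tail G e` and the point `ℓ e` is the end `head G e`.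
Which end of an edge is called the tail is an arbitrary choice; the substitution `t ↦ ℓ e - t` on
the edge `e` shows that nothing below depends on it. -/

/-- The end of the edge `e` at which the identification with `[0, ℓ e]` starts. -/
def tail {α : Type u} {β : Type v} (G : Graph α β) (e : E(G)) : α :=
  (G.exists_isLink_of_mem_edgeSet e.2).choose

/-- The end of the edge `e` at which the identification with `[0, ℓ e]` stops. -/
def head {α : Type u} {β : Type v} (G : Graph α β) (e : E(G)) : α :=
  (G.exists_isLink_of_mem_edgeSet e.2).choose_spec.choose

theorem isLink_tail_head {α : Type u} {β : Type v} (G : Graph α β) (e : E(G)) :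
    G.IsLink e.1 (tail G e) (head G e) :=
  (G.exists_isLink_of_mem_edgeSet e.2).choose_spec.choose_spec

/-- A metric on `G` assigns a positive length to each edge. -/
def IsMetric {α : Type u} {β : Type v} (G : Graph α β) (ℓ : E(G) → ℝ) : Prop :=
  ∀ e, 0 < ℓ e

/-- The length `L(G, ℓ)` of a finite metric graph. -/
def length {α : Type u} {β : Type v} (G : Graph α β) [Fintype E(G)] (ℓ : E(G) → ℝ) : ℝ :=
  ∑ e, ℓ e

open Classical in
/-- `f` solves the eigenvalue problem for the Laplacian on `(G, ℓ)` with Neumann vertex conditions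
and spectral parameter `μ` (the zero function is allowed).

A real function on the metric graph is represented by its restrictions `f e` to the edges. As only
the values of `f e` on `[0, ℓ e]` matter, `f e` is normalized to be zero elsewhere.
The witnesses are the values `val x` of `f` at the vertices and the derivatives `df e` of `f e`. -/
def SolvesNeumannProblem {α : Type u} {β : Type v} (G : Graph α β) [Fintype E(G)]
    (ℓ : E(G) → ℝ) (μ : ℝ) (f : E(G) → ℝ → ℝ) : Prop :=
  (∀ e, ∀ t ∉ Set.Icc 0 (ℓ e), f e t = 0) ∧
  ∃ (val : α → ℝ) (df : E(G) → ℝ → ℝ),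
    -- continuity at the vertices
    (∀ e, f e 0 = val (tail G e) ∧ f e (ℓ e) = val (head G e)) ∧
    -- the equation `-f'' = μ f` over each edge
    (∀ e, ∀ t ∈ Set.Icc 0 (ℓ e), HasDerivWithinAt (f e) (df e t) (Set.Icc 0 (ℓ e)) t) ∧
    (∀ e, ∀ t ∈ Set.Icc 0 (ℓ e),
      HasDerivWithinAt (df e) (-(μ * f e t)) (Set.Icc 0 (ℓ e)) t) ∧
    -- the derivatives at a vertex, directed away from it, sum to zero; a loop contributes twice
    (∀ x ∈ V(G), ∑ e : E(G),
      ((if tail G e = x then df e 0 else 0) + (if head G e = x then -(df e (ℓ e)) else 0)) = 0)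

/-- `μ` is the eigenvalue `λ_j(G, ℓ)`, where the eigenvalues of the Neumann problem are listed in
increasing order, starting from `j = 0` and repeated according to their multiplicities: the
eigenspaces for parameters smaller than `μ` span a space of dimension at most `j`, and the
eigenspaces for parameters at most `μ` span a space of dimension at least `j + 1`. At most one `μ`
has this property, and it is an eigenvalue. -/
def IsNthEigenvalue {α : Type u} {β : Type v} (G : Graph α β) [Fintype E(G)]
    (ℓ : E(G) → ℝ) (j : ℕ) (μ : ℝ) : Prop :=
  Module.rank ℝ (Submodule.span ℝ {f | ∃ ν < μ, SolvesNeumannProblem G ℓ ν f}) ≤ j ∧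
  (j : Cardinal) + 1 ≤
    Module.rank ℝ (Submodule.span ℝ {f | ∃ ν ≤ μ, SolvesNeumannProblem G ℓ ν f})

/-- `Λ` is the number `Λ_j(G)`, i.e. the smallest real number such that
`λ_j(G, ℓ) ≤ Λ / L(G, ℓ) ^ 2` for every metric `ℓ` on `G`. -/
def IsBigLambda {α : Type u} {β : Type v} (G : Graph α β) [Fintype E(G)]
    (j : ℕ) (Λ : ℝ) : Prop :=
  IsLeast {c : ℝ | ∀ ℓ : E(G) → ℝ, IsMetric G ℓ →
    ∃ μ, IsNthEigenvalue G ℓ j μ ∧ μ ≤ c / length G ℓ ^ 2} Λ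

end QuantumGraph

end

open scoped Graph

noncomputable section

namespace QuantumGraph

open Real

section

/-! ### Cotangents -/

/-! Let `v₀` be the vertex left out of the induced tree, write the spectral parameter as `s ^ 2`,
and let `L` be the total length and `β` the Betti number.

Upper bound: once `s * L > (1 + β) * π`, the energy `∫ f'² - s² f²` is nonpositive on a
two-dimensional space of functions vanishing at `v₀`. Subdividing every edge into pieces of phase
length below `π` makes this a statement about a finite quadratic form (`subdivForm`), whose kernel
corresponds to the eigenfunctions (`exists_ker_of_solves`, `exists_solves_of_ker`). Variables are
eliminated from `v₀` inwards along the `β` edges outside a spanning tree, and then back down the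
tree to `v₀`. The eliminated part hanging at a vertex contributes at most `-cot φ * f(v)²` with a
phase `φ` in `(0, π)`. A Dirichlet end starts with phase `π`; a segment of phase length `θ` turns
`φ` into `φ - θ`, or into `φ - θ + π` when it yields a free nonpositive direction; branches meeting
at a vertex have a joint phase at most the sum of their phases (`exists_cot_add`). The phase
arriving at `v₀` is positive, so the number `j` of gained half-turns satisfies `j * π > s * L - β *
π` up to an arbitrarily small slack, hence `j ≥ 2` (`exists_submodule_of_parent`). One of the two
dimensions pays for orthogonality to the constants, and a compactness argument produces the smallest
positive frequency (`exists_min_frequency`).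

Lower bound: give length `1` to the `β + 1` edges at `v₀` and a small length `ε` to the edges of the
induced tree. As `ε → 0` the graph degenerates to two vertices joined by `β + 1` unit edges, which
has no frequency in `(0, π)`; `exists_collapse` carries this over to some `ε > 0`. -/

theorem cot_sub_cot {a b : ℝ} (ha : sin a ≠ 0) (hb : sin b ≠ 0) :
    cot a - cot b = sin (b - a) / (sin a * sin b) := by
  rw [cot_eq_cos_div_sin, cot_eq_cos_div_sin, sin_sub]
  field_simp

theorem cot_le_cot {a b : ℝ} (ha : 0 < a) (hab : a ≤ b) (hb : b < π) : cot b ≤ cot a := by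
  have h1 : 0 < sin a := sin_pos_of_pos_of_lt_pi ha (by linarith)
  have h2 : 0 < sin b := sin_pos_of_pos_of_lt_pi (by linarith) hb
  have h3 : 0 ≤ sin (b - a) := sin_nonneg_of_nonneg_of_le_pi (by linarith) (by linarith)
  have := cot_sub_cot h1.ne' h2.ne'
  have : 0 ≤ cot a - cot b := by rw [this]; positivity
  linarith

theorem exists_cot_eq (c : ℝ) : ∃ χ, 0 < χ ∧ χ < π ∧ cot χ = c := by
  have h1 := neg_pi_div_two_lt_arctan c
  have h2 := arctan_lt_pi_div_two c
  refine ⟨π / 2 - arctan c, by linarith, by linarith, ?_⟩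
  rw [cot_eq_cos_div_sin, cos_pi_div_two_sub, sin_pi_div_two_sub, ← tan_eq_sin_div_cos, tan_arctan]

/-- The cotangent is superadditive, in the form in which it governs the phases of branches meeting
at a vertex. As `cot 0 = 0`, the phase `0` stands for the absence of a branch. -/
theorem exists_cot_add {φ ψ : ℝ} (hφ : 0 ≤ φ) (hφ' : φ < π) (hψ : 0 ≤ ψ) (hψ' : ψ < π) :
    ∃ χ, 0 ≤ χ ∧ χ < π ∧ χ ≤ φ + ψ ∧ (0 < φ ∨ 0 < ψ → 0 < χ) ∧ cot χ = cot φ + cot ψ := by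
  have cot0 : cot (0 : ℝ) = 0 := by simp [cot_eq_cos_div_sin]
  rcases hφ.eq_or_lt with rfl | h1
  · exact ⟨ψ, hψ, hψ', by simp, by simp, by simp [cot0]⟩
  rcases hψ.eq_or_lt with rfl | h2
  · exact ⟨φ, hφ, hφ', by simp, by simp, by simp [cot0]⟩
  obtain ⟨χ, h3, h4, h5⟩ := exists_cot_eq (cot φ + cot ψ)
  refine ⟨χ, h3.le, h4, ?_, fun _ => h3, h5⟩
  -- If `χ` exceeded `φ + ψ`, then `φ + ψ < π` and `cot` would be strictly decreasing between them.
  -- But `cot φ + cot ψ - cot (φ + ψ)` has the sign of `a ^ 2 + a * b + b ^ 2 + c ^ 2`, where `a =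
  -- sin φ * cos ψ`, `b = cos φ * sin ψ` and `c = sin φ * sin ψ`.
  by_contra! hlt
  have s1 := sin_pos_of_pos_of_lt_pi h1 hφ'
  have s2 := sin_pos_of_pos_of_lt_pi h2 hψ'
  have s3 := sin_pos_of_pos_of_lt_pi (x := φ + ψ) (by linarith) (by linarith)
  have s4 := sin_pos_of_pos_of_lt_pi h3 h4
  have s5 := sin_pos_of_pos_of_lt_pi (x := χ - (φ + ψ)) (by linarith) (by linarith)
  have e1 := cot_sub_cot s3.ne' s4.ne'
  have p1 : 0 < cot (φ + ψ) - cot χ := by rw [e1]; positivity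
  have key : (cot φ + cot ψ - cot (φ + ψ)) * (sin φ * sin ψ * sin (φ + ψ)) =
      sin (φ + ψ) ^ 2 - sin φ * sin ψ * cos (φ + ψ) := by
    rw [cot_eq_cos_div_sin, cot_eq_cos_div_sin, cot_eq_cos_div_sin]
    field_simp
    rw [sin_add]; ring
  have key2 : sin (φ + ψ) ^ 2 - sin φ * sin ψ * cos (φ + ψ) =
     (sin φ * cos ψ)^2 + (cos φ * sin ψ)^2 + sin φ * sin ψ * cos φ * cos ψ + (sin φ * sin ψ)^2 := by
    rw [sin_add, cos_add]; ring
  have key3 : 0 ≤ sin (φ + ψ) ^ 2 - sin φ * sin ψ * cos (φ + ψ) := by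
    rw [key2]
    nlinarith [sq_nonneg (sin φ * cos ψ + cos φ * sin ψ), sq_nonneg (sin φ * cos ψ),
      sq_nonneg (cos φ * sin ψ), sq_nonneg (sin φ * sin ψ)]
  rw [← key] at key3
  have := nonneg_of_mul_nonneg_left key3 (by positivity)
  linarith

/-- The energy of the solution of `-f'' = f` on `[0, θ]` with boundary values `a`, `b`. -/
def segmentEnergy (θ a b : ℝ) : ℝ := (cos θ * (a ^ 2 + b ^ 2) - 2 * a * b) / sin θ

theorem segmentEnergy_comm (θ a b : ℝ) : segmentEnergy θ a b = segmentEnergy θ b a := by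
  unfold segmentEnergy; ring

theorem segmentEnergy_zero_left (θ b : ℝ) : segmentEnergy θ 0 b = cot θ * b ^ 2 := by
  unfold segmentEnergy; rw [cot_eq_cos_div_sin]; ring

/-- One elimination step of Gauss. For phases in `(0, π)` the square has the sign of `sin (φ - θ)`,
which decides whether it can be dropped for free or must be killed by a linear condition. -/
theorem segmentEnergy_completeSquare {φ θ : ℝ} (hφ : sin φ ≠ 0) (hθ : sin θ ≠ 0)
    (hs : sin (φ - θ) ≠ 0) (a b : ℝ) :
    -cot φ * a ^ 2 + segmentEnergy θ a b =
      -cot (φ - θ) * b ^ 2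
        + sin (φ - θ) / (sin φ * sin θ) * (a - sin φ / sin (φ - θ) * b) ^ 2 := by
  unfold segmentEnergy
  rw [cot_eq_cos_div_sin, cot_eq_cos_div_sin]
  field_simp
  have h1 : cos φ ^ 2 = 1 - sin φ ^ 2 := by rw [← sin_sq_add_cos_sq φ]; ring
  have h2 : cos θ ^ 2 = 1 - sin θ ^ 2 := by rw [← sin_sq_add_cos_sq θ]; ring
  rw [sin_sub, cos_sub]
  ring_nf
  simp only [h1, h2]
  ring_nf

/-! ### Elimination of variables by phases. -/

section Elimination

variable {M : Type*} [AddCommGroup M] [Module ℝ M]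

theorem finrank_le_inf_ker [FiniteDimensional ℝ M] (Z : Submodule ℝ M) (g : M →ₗ[ℝ] ℝ) :
    Module.finrank ℝ Z ≤ Module.finrank ℝ (Z ⊓ LinearMap.ker g : Submodule ℝ M) + 1 := by
  have h1 := LinearMap.finrank_range_add_finrank_ker (g.comp Z.subtype)
  have h2 : Module.finrank ℝ (LinearMap.range (g.comp Z.subtype)) ≤ 1 := by
    simpa using Submodule.finrank_le (LinearMap.range (g.comp Z.subtype))
  have h3 : Module.finrank ℝ (LinearMap.ker (g.comp Z.subtype)) =
      Module.finrank ℝ (Z ⊓ LinearMap.ker g : Submodule ℝ M) := by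
    rw [← Submodule.map_comap_subtype, LinearMap.ker_comp]
    exact (Submodule.equivMapOfInjective Z.subtype Z.injective_subtype _).finrank_eq
  omega

/-- Propagation of a phase along a segment. -/
theorem exists_submodule_segment [FiniteDimensional ℝ M] (Z : Submodule ℝ M) (a b : M →ₗ[ℝ] ℝ) {φ θ η : ℝ}
    (hφ : 0 < φ) (hφ' : φ < π) (hθ : 0 < θ) (hθ' : θ < π) (hη : 0 < η) :
    ∃ Z' ≤ Z, ∃ (j : ℕ) (χ : ℝ), 0 < χ ∧ χ < π ∧ χ ≤ φ + j * π - θ + η ∧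
      Module.finrank ℝ Z + j ≤ Module.finrank ℝ Z' + 1 ∧
      ∀ z ∈ Z', -cot φ * (a z) ^ 2 + segmentEnergy θ (a z) (b z) ≤ -cot χ * (b z) ^ 2 := by
  -- Positive square: impose its vanishing, at the cost of one dimension and with `j = 0`. Replacing
  -- `φ` by a larger `ψ` only weakens the bound, as `-cot` increases.
  have hgt : ∀ ψ, 0 < ψ → ψ < π → φ ≤ ψ → θ < ψ → ψ ≤ φ + η →
      ∃ Z' ≤ Z, ∃ (j : ℕ) (χ : ℝ), 0 < χ ∧ χ < π ∧ χ ≤ φ + j * π - θ + η ∧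
      Module.finrank ℝ Z + j ≤ Module.finrank ℝ Z' + 1 ∧
      ∀ z ∈ Z', -cot φ * (a z) ^ 2 + segmentEnergy θ (a z) (b z) ≤ -cot χ * (b z) ^ 2 := by
    intro ψ h1 h2 h3 h4 h5
    refine ⟨Z ⊓ LinearMap.ker (a - (sin ψ / sin (ψ - θ)) • b), inf_le_left, 0, ψ - θ,
      by linarith, by linarith, by simp; linarith, ?_, ?_⟩
    · simpa using finrank_le_inf_ker Z (a - (sin ψ / sin (ψ - θ)) • b)
    · intro z hz
      have hz2 : a z - sin ψ / sin (ψ - θ) * b z = 0 := by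
        simpa using (Submodule.mem_inf.1 hz).2
      have := segmentEnergy_completeSquare (sin_pos_of_pos_of_lt_pi h1 h2).ne'
        (sin_pos_of_pos_of_lt_pi hθ hθ').ne'
        (sin_pos_of_pos_of_lt_pi (x := ψ - θ) (by linarith) (by linarith)).ne' (a z) (b z)
      rw [hz2] at this
      have h6 := cot_le_cot hφ h3 h2
      nlinarith [sq_nonneg (a z)]
  rcases lt_trichotomy φ θ with h | h | h
  -- Nonpositive square: drop it. No dimension is lost, and the phase gains a half-turn to stay in
  -- `(0, π)`.
  · refine ⟨Z, le_rfl, 1, φ + π - θ, by linarith, by linarith, by simp; linarith, le_rfl, ?_⟩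
    intro z _
    have s1 := sin_pos_of_pos_of_lt_pi hφ hφ'
    have s2 := sin_pos_of_pos_of_lt_pi hθ hθ'
    have s3 : sin (φ - θ) < 0 := sin_neg_of_neg_of_neg_pi_lt (by linarith) (by linarith)
    rw [segmentEnergy_completeSquare s1.ne' s2.ne' s3.ne]
    have : cot (φ + π - θ) = cot (φ - θ) := by
      rw [show φ + π - θ = (φ - θ) + π by ring, cot_eq_cos_div_sin, cot_eq_cos_div_sin,
        cos_add_pi, sin_add_pi, neg_div_neg_eq]
    rw [this]
    have : sin (φ - θ) / (sin φ * sin θ) ≤ 0 := div_nonpos_of_nonpos_of_nonneg s3.le (by positivity)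
    nlinarith [sq_nonneg (a z - sin φ / sin (φ - θ) * b z)]
  -- At `φ = θ` the square cannot be completed, so `φ` is widened by less than `η`; this is the only
  -- source of the slack.
  · obtain ⟨ψ, h1, h2⟩ := exists_between (lt_min (lt_add_of_pos_right φ hη) hφ')
    exact hgt ψ (by linarith) (h2.trans_le (min_le_right _ _)) h1.le (by linarith)
      (h2.le.trans (min_le_left _ _))
  · exact hgt φ hφ hφ' le_rfl h (by linarith)

/-- The energy of a chain of `N` segments. -/
def chainEnergy (θ : ℝ) (N : ℕ) (x : ℕ → ℝ) : ℝ :=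
  ∑ k ∈ Finset.range N, segmentEnergy θ (x k) (x (k + 1))

/-- Each segment either loses a dimension or gains a half-turn, so over the chain dimensions lost
plus half-turns gained are at most `N`. -/
theorem exists_submodule_chain [FiniteDimensional ℝ M] (Z : Submodule ℝ M) (g : ℕ → M →ₗ[ℝ] ℝ) {φ θ η : ℝ}
    (hφ : 0 < φ) (hφ' : φ < π) (hθ : 0 < θ) (hθ' : θ < π) (hη : 0 < η) (N : ℕ) :
    ∃ Z' ≤ Z, ∃ (j : ℕ) (χ : ℝ), 0 < χ ∧ χ < π ∧ χ ≤ φ + j * π - N * θ + N * η ∧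
      Module.finrank ℝ Z + j ≤ Module.finrank ℝ Z' + N ∧
      ∀ z ∈ Z', -cot φ * (g 0 z) ^ 2 + chainEnergy θ N (fun k => g k z) ≤
        -cot χ * (g N z) ^ 2 := by
  induction N with
  | zero => exact ⟨Z, le_rfl, 0, φ, hφ, hφ', by simp, by simp, by simp [chainEnergy]⟩
  | succ N ih =>
    obtain ⟨Z₁, hZ₁, j₁, χ₁, a1, a2, a3, a4, a5⟩ := ih
    obtain ⟨Z₂, hZ₂, j₂, χ₂, b1, b2, b3, b4, b5⟩ :=
      exists_submodule_segment Z₁ (g N) (g (N + 1)) a1 a2 hθ hθ' hη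
    refine ⟨Z₂, hZ₂.trans hZ₁, j₁ + j₂, χ₂, b1, b2, ?_, by omega, ?_⟩
    · push_cast; linarith
    · intro z hz
      have h1 := a5 z (hZ₂ hz)
      have h2 := b5 z hz
      unfold chainEnergy at h1 ⊢
      rw [Finset.sum_range_succ]
      linarith

variable {V : Type*}

/-- On a subspace of `Z₀`, the energy `R` is bounded by the energies `-cot (φ v) * (val v) ^ 2` of
branches ending at the vertices in `B`. The numbers `τ` and `r` record the total phase and the
number of eliminated variables; the vertices in `P` carry branches. -/
def Reduces (Z₀ : Submodule ℝ M) (val : V → M →ₗ[ℝ] ℝ) (B P : Finset V) (R : M → ℝ)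
    (τ : ℝ) (r : ℕ) : Prop :=
  ∃ Z ≤ Z₀, ∃ (j : ℕ) (φ : V → ℝ), (∀ v, 0 ≤ φ v ∧ φ v < π) ∧ (∀ v ∈ P, 0 < φ v) ∧
    ∑ v ∈ B, φ v ≤ j * π + τ ∧ Module.finrank ℝ Z₀ + j ≤ Module.finrank ℝ Z + r ∧
    ∀ z ∈ Z, R z ≤ ∑ v ∈ B, -cot (φ v) * (val v z) ^ 2

variable {Z₀ : Submodule ℝ M} {val : V → M →ₗ[ℝ] ℝ} {B P : Finset V} {R : M → ℝ} {τ : ℝ} {r : ℕ}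

theorem reduces_zero (Z₀ : Submodule ℝ M) (val : V → M →ₗ[ℝ] ℝ) (B : Finset V) :
    Reduces Z₀ val B ∅ (fun _ => 0) 0 0 :=
  ⟨Z₀, le_rfl, 0, fun _ => 0, fun _ => ⟨le_rfl, pi_pos⟩, by simp, by simp, by simp,
    by simp [cot_eq_cos_div_sin]⟩

/-- Two branches at `w` add their cotangents; `exists_cot_add` merges them into one phase without
increasing the total. -/
theorem Reduces.add_branch [DecidableEq V] {Z₁ : Submodule ℝ M} {j : ℕ} {φ : V → ℝ} {χ : ℝ} (hZ₁ : Z₁ ≤ Z₀)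
    (hφ : ∀ v, 0 ≤ φ v ∧ φ v < π) (hP : ∀ v ∈ P, 0 < φ v) {w : V} (hw : w ∈ B)
    (hχ : 0 < χ) (hχ' : χ < π)
    (hτ : ∑ v ∈ B, φ v + χ ≤ j * π + τ)
    (hr : Module.finrank ℝ Z₀ + j ≤ Module.finrank ℝ Z₁ + r)
    (hR : ∀ z ∈ Z₁, R z ≤ ∑ v ∈ B, -cot (φ v) * (val v z) ^ 2 + -cot χ * (val w z) ^ 2) :
    Reduces Z₀ val B (insert w P) R τ r := by
  obtain ⟨ψ, h1, h2, h3, h4, h5⟩ := exists_cot_add (hφ w).1 (hφ w).2 hχ.le hχ'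
  refine ⟨Z₁, hZ₁, j, Function.update φ w ψ, ?_, ?_, ?_, hr, ?_⟩
  · intro v
    rcases eq_or_ne v w with rfl | hv
    · simpa using ⟨h1, h2⟩
    · simpa [hv] using hφ v
  · intro v hv
    rcases eq_or_ne v w with rfl | hvw
    · simpa using h4 (Or.inr hχ)
    · simpa [hvw] using hP v ((Finset.mem_insert.1 hv).resolve_left hvw)
  · rw [← Finset.add_sum_erase _ _ hw] at hτ ⊢
    have : ∑ x ∈ B.erase w, Function.update φ w ψ x = ∑ x ∈ B.erase w, φ x :=
      Finset.sum_congr rfl fun x hx => by simp [Finset.ne_of_mem_erase hx]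
    rw [this]
    simp only [Function.update_self]
    linarith
  · intro z hz
    refine (hR z hz).trans (le_of_eq ?_)
    rw [← Finset.add_sum_erase _ _ hw, ← Finset.add_sum_erase B _ hw]
    have : ∑ x ∈ B.erase w, -cot (Function.update φ w ψ x) * (val x z) ^ 2 =
        ∑ x ∈ B.erase w, -cot (φ x) * (val x z) ^ 2 :=
      Finset.sum_congr rfl fun x hx => by simp [Finset.ne_of_mem_erase hx]
    rw [this]
    simp only [Function.update_self, h5]
    ring

/-- Attaching a chain that starts at a Dirichlet point. -/
theorem Reduces.leaf [DecidableEq V] [FiniteDimensional ℝ M] (H : Reduces Z₀ val B P R τ r) {w : V} (hw : w ∈ B) (g : ℕ → M →ₗ[ℝ] ℝ)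
    (N : ℕ) (h0 : ∀ z ∈ Z₀, g 0 z = 0) (hN : g (N + 1) = val w) {θ η : ℝ}
    (hθ : 0 < θ) (hθ' : θ < π) (hη : 0 < η) :
    Reduces Z₀ val B (insert w P) (fun z => R z + chainEnergy θ (N + 1) (fun k => g k z))
      (τ + π - (N + 1 : ℕ) * θ + N * η) (r + N) := by
  obtain ⟨Z, hZ, j, φ, c1, c2, c3, c4, c5⟩ := H
  -- Since the value at the start is zero, the first segment has energy `cot θ * b ^ 2`, that is,
  -- phase `π - θ` at no cost. Only the remaining `N` segments eliminate variables.
  obtain ⟨Z₁, hZ₁, j₁, χ, a1, a2, a3, a4, a5⟩ :=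
    exists_submodule_chain Z (fun k => g (k + 1)) (φ := π - θ) (by linarith) (by linarith)
      hθ hθ' hη N
  refine Reduces.add_branch (Z₁ := Z₁) (j := j + j₁) (φ := φ) (χ := χ) (hZ₁.trans hZ) c1 c2 hw
    a1 a2 ?_ (by omega) ?_
  · push_cast; linarith
  · intro z hz
    have h1 := a5 z hz
    have h2 := c5 z (hZ₁ hz)
    have h3 : cot (π - θ) = -cot θ := by
      rw [cot_eq_cos_div_sin, cot_eq_cos_div_sin, cos_pi_sub, sin_pi_sub, neg_div]
    rw [h3] at h1
    unfold chainEnergy at h1 ⊢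
    rw [Finset.sum_range_succ']
    simp only [zero_add, hN, h0 z (hZ (hZ₁ hz)), segmentEnergy_zero_left] at h1 ⊢
    linarith

/-- Eliminating a vertex through a chain leading to another vertex. -/
theorem Reduces.elim [DecidableEq V] [FiniteDimensional ℝ M] (H : Reduces Z₀ val B P R τ r) {v w : V} (hv : v ∈ B) (hvP : v ∈ P)
    (hw : w ∈ B) (hvw : w ≠ v) (g : ℕ → M →ₗ[ℝ] ℝ)
    (N : ℕ) (h0 : g 0 = val v) (hN : g N = val w) {θ η : ℝ}
    (hθ : 0 < θ) (hθ' : θ < π) (hη : 0 < η) :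
    Reduces Z₀ val (B.erase v) (insert w P) (fun z => R z + chainEnergy θ N (fun k => g k z))
      (τ - N * θ + N * η) (r + N) := by
  obtain ⟨Z, hZ, j, φ, c1, c2, c3, c4, c5⟩ := H
  obtain ⟨Z₁, hZ₁, j₁, χ, a1, a2, a3, a4, a5⟩ :=
    exists_submodule_chain Z g (c2 v hvP) (c1 v).2 hθ hθ' hη N
  rw [← Finset.add_sum_erase _ _ hv] at c3
  refine Reduces.add_branch (Z₁ := Z₁) (j := j + j₁) (φ := φ) (χ := χ) (hZ₁.trans hZ) c1 c2
    (Finset.mem_erase.2 ⟨hvw, hw⟩) a1 a2 ?_ (by omega) ?_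
  · push_cast; linarith
  · intro z hz
    have h1 := a5 z hz
    have h2 := c5 z (hZ₁ hz)
    rw [← Finset.add_sum_erase _ _ hv] at h2
    rw [h0, hN] at h1
    linarith

end Elimination

end

section

/-! ### Trees and spanning trees -/

section Trees

universe u v
variable {α : Type u} {β : Type v} {G : Graph α β}

/-- The simple graph on a vertex set of a loopless multigraph. -/
def simpleGraphOn (G : Graph α β) (hloop : ∀ e x, ¬ G.IsLoopAt e x) (X : Set α) :
    SimpleGraph X where
  Adj x y := G.Adj x y
  symm := ⟨fun _ _ h => h.symm⟩
  loopless := ⟨fun x ⟨e, he⟩ => hloop e x he⟩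

/-- Passing to a simple graph gives access to distances and unique paths. A cycle of the simple
graph lifts by choosing an edge for each adjacency. -/
theorem simpleGraphOn_isTree (hloop : ∀ e x, ¬ G.IsLoopAt e x) {X : Set α}
    (hX : IsTree (G.induce X)) : (simpleGraphOn G hloop X).IsTree := by
  obtain ⟨⟨⟨x₀, hx₀⟩, hconn⟩, hcyc⟩ := hX
  refine ⟨?_, ?_⟩
  · have : Nonempty X := ⟨⟨x₀, hx₀⟩⟩
    refine ⟨fun x y => ?_⟩
    have key : ∀ b, Relation.ReflTransGen (G.induce X).Adj x b → ∀ hb : b ∈ X,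
        (simpleGraphOn G hloop X).Reachable x ⟨b, hb⟩ := by
      intro b h
      induction h with
      | refl => intro _; exact SimpleGraph.Reachable.refl _
      | tail _ h2 ih =>
        intro hb
        obtain ⟨e, he⟩ := h2
        exact (ih he.2.1).trans (SimpleGraph.Adj.reachable ⟨e, he.1⟩)
    exact key y (hconn x x.2 y y.2) y.2
  · rw [SimpleGraph.isAcyclic_iff_free_cycleGraph]
    rintro n hn ⟨f⟩
    obtain ⟨n, rfl⟩ : ∃ k, n = k + 3 := ⟨n - 3, by omega⟩
    have hadj : ∀ i : Fin (n + 3), (SimpleGraph.cycleGraph (n + 3)).Adj i (i + 1) := by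
      intro i
      rw [SimpleGraph.cycleGraph_adj]
      right
      simp
    have hadj' : ∀ i : Fin (n + 3), G.Adj (f i) (f (i + 1)) := fun i => f.toHom.map_adj (hadj i)
    choose e he using hadj'
    have hf : Function.Injective fun i => (f i : α) := Subtype.val_injective.comp f.injective
    refine hcyc ⟨n + 2, fun i => f i, e, hf, ?_, fun i => ⟨he i, (f i).2, (f (i + 1)).2⟩⟩
    intro (i : Fin (n + 3)) (j : Fin (n + 3)) hij
    have h1 := he i
    rw [hij] at h1
    rcases h1.eq_and_eq_or_eq_and_eq (he j) with ⟨h, _⟩ | ⟨h, h'⟩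
    · exact hf h
    -- One edge used in both directions would force `2 = 0` in `Fin (n + 3)`.
    · have e1 : i = j + 1 := hf h
      have e2 : i + 1 = j := hf h'
      rw [e1, add_assoc] at e2
      have : (1 + 1 : Fin (n + 3)) = 0 := by simpa using e2
      have := congrArg Fin.val this
      simp only [Fin.val_add, Fin.coe_ofNat_eq_mod, Nat.add_mod_mod, Nat.mod_add_mod,
        Nat.zero_mod] at this
      rw [Nat.mod_eq_of_lt (by omega)] at this
      omega

/-- Parallel edges would form a cycle of length two. -/
theorem eq_of_isLink_of_isTree {X : Set α} (hloop : ∀ e x, ¬ G.IsLoopAt e x)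
    (hX : IsTree (G.induce X)) {x y : α} (hx : x ∈ X)
    (hy : y ∈ X) {e e' : β} (he : G.IsLink e x y) (he' : G.IsLink e' x y) : e = e' := by
  by_contra hne
  have hxy : x ≠ y := fun h => hloop e x (by subst h; exact he)
  refine hX.2 ⟨1, ![x, y], ![e, e'], ?_, ?_, ?_⟩
  · intro i j h
    fin_cases i <;> fin_cases j <;> simp_all
  · intro i j h
    fin_cases i <;> fin_cases j <;> simp_all
  · intro i
    fin_cases i
    · exact ⟨he, hx, hy⟩
    · exact ⟨he'.symm, hy, hx⟩

/-- A tree induced on all vertices but `v₀`, together with one edge at `v₀`, is a spanning tree: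
it is described by the parent `p v` and the parent edge `pe v` of each vertex `v ≠ v₀`. All other
edges are incident to `v₀`. -/
theorem exists_parent (hloop : ∀ e x, ¬ G.IsLoopAt e x) (hconn : Connected G) {X : Set α} {v₀ : α}
    (hv₀ : v₀ ∉ X) (hV : V(G) = insert v₀ X) (hX : IsTree (G.induce X)) :
    ∃ (p : α → α) (pe : α → E(G)) (dep : α → ℕ) (r : α), r ∈ X ∧ p r = v₀ ∧
      (∀ v ∈ X, v ≠ r → p v ∈ X) ∧ (∀ v ∈ X, G.IsLink (pe v).1 v (p v) ∧ dep (p v) < dep v) ∧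
      Set.InjOn pe X ∧ ∀ e : E(G), e ∉ pe '' X → ∃ v ∈ X, G.IsLink e.1 v v₀ := by
  classical
  have hT := simpleGraphOn_isTree hloop hX
  set T := simpleGraphOn G hloop X with hTdef
  obtain ⟨r, hr, e₀, he₀⟩ : ∃ r ∈ X, ∃ e, G.IsLink e r v₀ := by
    obtain ⟨x, hx⟩ := hX.1.1
    have h := hconn.2 v₀ (by simp [hV]) x (by rw [hV]; exact Or.inr hx)
    rcases Relation.ReflTransGen.cases_head h with rfl | ⟨y, ⟨e, he⟩, _⟩
    · exact absurd hx hv₀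
    · refine ⟨y, ?_, e, he.symm⟩
      have := he.right_mem
      rw [hV] at this
      refine this.resolve_left ?_
      rintro rfl
      exact hloop e y he
  have hpath : ∀ v : X, ∃ q : T.Walk ⟨r, hr⟩ v, q.IsPath ∧ q.length = T.dist ⟨r, hr⟩ v :=
    fun v => hT.connected.exists_path_of_dist _ _
  choose q hq hql using hpath
  have hnil : ∀ v : X, v ≠ ⟨r, hr⟩ → ¬ (q v).Nil := by
    intro v hv h
    exact hv h.eq.symm
  have hadj : ∀ v : X, v ≠ ⟨r, hr⟩ → ∃ e, G.IsLink e v ((q v).penultimate : X) := fun v hv =>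
    ((q v).adj_penultimate (hnil v hv)).symm
  let p : α → α := fun v => if h : v ∈ X ∧ v ≠ r then ((q ⟨v, h.1⟩).penultimate : X) else v₀
  -- The shift by one puts `v₀`, which has depth `0`, strictly below the root `r`.
  let dep : α → ℕ := fun v => if h : v ∈ X then T.dist ⟨r, hr⟩ ⟨v, h⟩ + 1 else 0
  have hpX : ∀ v ∈ X, v ≠ r → p v ∈ X := fun v hv hvr => by simp [p, hv, hvr]
  have hpr : p r = v₀ := by simp [p]
  have hpe : ∀ v, ∃ e : E(G), v ∈ X → G.IsLink e.1 v (p v) := by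
    intro v
    by_cases hv : v ∈ X
    · by_cases hvr : v = r
      · subst hvr; exact ⟨⟨e₀, he₀.edge_mem⟩, fun _ => by rw [hpr]; exact he₀⟩
      · obtain ⟨e, he⟩ := hadj ⟨v, hv⟩ (by simpa using hvr)
        exact ⟨⟨e, he.edge_mem⟩, fun _ => by simpa [p, hv, hvr] using he⟩
    · exact ⟨⟨e₀, he₀.edge_mem⟩, fun h => absurd h hv⟩
  choose pe hpe using hpe
  have hdep : ∀ v ∈ X, dep (p v) < dep v := by
    intro v hv
    by_cases hvr : v = r
    · subst hvr; simp [hpr, dep, hv₀, hv]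
    · have h1 : T.dist ⟨r, hr⟩ (q ⟨v, hv⟩).penultimate ≤ (q ⟨v, hv⟩).dropLast.length :=
        SimpleGraph.dist_le _
      have h2 : (q ⟨v, hv⟩).dropLast.length + 1 = (q ⟨v, hv⟩).length :=
        SimpleGraph.Walk.length_dropLast_add_one (hnil ⟨v, hv⟩ (by simpa using hvr))
      have h3 := hql ⟨v, hv⟩
      simp only [dep, p, hv, hvr, ne_eq, not_false_eq_true, and_self, dite_true,
        Subtype.coe_prop]
      simp only [Subtype.coe_eta]
      omega
  refine ⟨p, pe, dep, r, hr, hpr, hpX, fun v hv => ⟨hpe v hv, hdep v hv⟩, ?_, ?_⟩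
  · intro v hv w hw hvw
    have h1 := hpe v hv
    rw [hvw] at h1
    rcases h1.eq_and_eq_or_eq_and_eq (hpe w hw) with ⟨h, _⟩ | ⟨h, h'⟩
    · exact h
    · have := hdep v hv
      have := hdep w hw
      rw [h'] at *
      rw [h] at *
      omega
  · rintro ⟨e, he⟩ hne
    obtain ⟨x, y, hxy⟩ := G.exists_isLink_of_mem_edgeSet he
    have hx := hxy.left_mem
    have hy := hxy.right_mem
    rw [hV] at hx hy
    rcases hx with rfl | hx
    · refine ⟨y, hy.resolve_left ?_, hxy.symm⟩
      rintro rfl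
      exact hloop e y hxy
    rcases hy with rfl | hy
    · exact ⟨x, hx, hxy⟩
    exfalso
    apply hne
    -- In a tree, of two adjacent vertices one lies on the path from `r` to the other, and is then
    -- its parent; without parallel edges the edge is the parent edge.
    have key : ∀ x y : X, G.IsLink e x y → y ∈ (q x).support → ⟨e, he⟩ ∈ pe '' X := by
      intro x y hxy hsup
      have h1 : y = (q x).penultimate :=
        hT.isAcyclic.eq_penultimate_of_adj_end (hq x) ⟨e, hxy⟩ hsup
      have hxr : (x : α) ≠ r := by
        intro hxr
        have hx' : x = ⟨r, hr⟩ := Subtype.ext hxr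
        subst hx'
        have : (q ⟨r, hr⟩).length = 0 := by rw [hql]; simp
        have hn := SimpleGraph.Walk.length_eq_zero_iff.1 this
        rw [SimpleGraph.Walk.nil_iff_support_eq.1 hn] at hsup
        have : y = ⟨r, hr⟩ := by simpa using hsup
        subst this
        exact hloop e r hxy
      have hp : p x = y := by simp [p, hxr, h1]
      refine ⟨x, x.2, ?_⟩
      refine Subtype.ext (eq_of_isLink_of_isTree hloop hX x.2 y.2 ?_ hxy)
      rw [← hp]; exact hpe x x.2
    by_cases hsup : (⟨x, hx⟩ : X) ∈ (q ⟨y, hy⟩).support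
    · exact key ⟨y, hy⟩ ⟨x, hx⟩ hxy.symm hsup
    · exact key ⟨x, hx⟩ ⟨y, hy⟩ hxy (hT.isAcyclic.mem_support_of_ne_mem_support_of_adj_of_isPath
        (hq ⟨x, hx⟩) (hq ⟨y, hy⟩) ⟨e, hxy⟩ hsup)

end Trees

end

section

/-! ### Networks

The energy form at frequency `s` of a finite network whose edges `f`, of length `h f`, join the
nodes `a f` and `b f`. It is written so as to be continuous at `s = 0`. -/

theorem sinc_pos {x : ℝ} (h0 : 0 ≤ x) (h1 : x < π) : 0 < sinc x := by
  rcases h0.eq_or_lt with rfl | h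
  · simp
  · rw [sinc_of_ne_zero h.ne']
    exact div_pos (sin_pos_of_pos_of_lt_pi h h1) h

/-- The function `s ↦ tan (s * h / 2) / s`, extended continuously to `s = 0`. -/
def massWeight (s h : ℝ) : ℝ := h / 2 * sinc (s * h / 2) / cos (s * h / 2)

theorem massWeight_pos {s h : ℝ} (h0 : 0 < h) (hs : 0 ≤ s) (h1 : s * h < π) :
    0 < massWeight s h := by
  have h2 : 0 ≤ s * h := by positivity
  have : 0 < sinc (s * h / 2) := sinc_pos (by positivity) (by linarith)
  have : 0 < cos (s * h / 2) := cos_pos_of_mem_Ioo ⟨by linarith, by linarith⟩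
  unfold massWeight
  positivity

theorem continuousOn_massWeight {h S : ℝ} (hh : 0 < h) (hS : S * h < π) :
    ContinuousOn (fun s => massWeight s h) (Set.Icc 0 S) := by
  unfold massWeight
  refine ContinuousOn.div ?_ (by fun_prop) ?_
  · exact (continuous_const.mul (continuous_sinc.comp (by fun_prop))).continuousOn
  · intro s hs
    have h1 : s * h < π := (mul_le_mul_of_nonneg_right hs.2 hh.le).trans_lt hS
    have h2 : 0 ≤ s * h := mul_nonneg hs.1 hh.le
    exact (cos_pos_of_mem_Ioo ⟨by linarith, by linarith⟩).ne'

/-- The identity behind it is `1 / sin θ - tan (θ / 2) = cot θ` with `θ = s * h`: the left side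
stays regular at `s = 0`, the right side is the energy used in the elimination. -/
theorem form_term {s h : ℝ} (h0 : 0 < s * h) (h1 : s * h < π) (x x' y y' : ℝ) :
    (x - x') * (y - y') / (h * sinc (s * h)) - s ^ 2 * massWeight s h * (x * y + x' * y') =
      s * ((cos (s * h) * (x * y + x' * y') - x * y' - x' * y) / sin (s * h)) := by
  have hs : s ≠ 0 := left_ne_zero_of_mul h0.ne'
  have hh : h ≠ 0 := right_ne_zero_of_mul h0.ne'
  have e1 : sin (s * h) = 2 * sin (s * h / 2) * cos (s * h / 2) := by
    rw [← sin_two_mul]; congr 1; ring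
  have e2 : cos (s * h) = 1 - 2 * sin (s * h / 2) ^ 2 := by
    rw [← cos_sq_add_sin_sq (s * h / 2), show s * h = 2 * (s * h / 2) by ring, cos_two_mul]
    rw [show 2 * (s * h / 2) / 2 = s * h / 2 by ring]
    linarith [cos_sq_add_sin_sq (s * h / 2)]
  have p1 : sin (s * h / 2) ≠ 0 := (sin_pos_of_pos_of_lt_pi (by linarith) (by linarith)).ne'
  have p2 : cos (s * h / 2) ≠ 0 := (cos_pos_of_mem_Ioo ⟨by linarith, by linarith⟩).ne'
  rw [massWeight, sinc_of_ne_zero h0.ne', sinc_of_ne_zero (by linarith : s * h / 2 ≠ 0), e1, e2]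
  field_simp
  ring

section Network

variable {I F : Type*} [Fintype F] (a b : F → I) (h : F → ℝ)

/-- The energy form at frequency `s`. -/
def form (s : ℝ) (x y : I → ℝ) : ℝ :=
  ∑ f, ((x (a f) - x (b f)) * (y (a f) - y (b f)) / (h f * sinc (s * h f)) -
    s ^ 2 * massWeight s (h f) * (x (a f) * y (a f) + x (b f) * y (b f)))

/-- The pairing of `x` with the constants, up to the factor `-s ^ 2`. -/
def meanForm (s : ℝ) : (I → ℝ) →ₗ[ℝ] ℝ :=
  ∑ f, massWeight s (h f) • ((LinearMap.proj (a f) : (I → ℝ) →ₗ[ℝ] ℝ) + LinearMap.proj (b f))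

/-- The total mass. -/
def totalMass (s : ℝ) : ℝ := ∑ f : F, 2 * massWeight s (h f)

/-- The energy form reduced by the constants. -/
def reducedForm (s : ℝ) (x y : I → ℝ) : ℝ :=
  form a b h s x y + s ^ 2 * (meanForm a b h s x * meanForm a b h s y) / totalMass h s

variable {a b h}

theorem meanForm_apply (s : ℝ) (x : I → ℝ) :
    meanForm a b h s x = ∑ f, massWeight s (h f) * (x (a f) + x (b f)) := by
  simp [meanForm, mul_add]

theorem form_comm (s : ℝ) (x y : I → ℝ) : form a b h s x y = form a b h s y x :=
  Finset.sum_congr rfl fun f _ => by ring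

theorem form_add_smul_left (s t : ℝ) (x y z : I → ℝ) :
    form a b h s (x + t • y) z = form a b h s x z + t * form a b h s y z := by
  simp only [form, Finset.mul_sum, ← Finset.sum_add_distrib, Pi.add_apply, Pi.smul_apply,
    smul_eq_mul]
  exact Finset.sum_congr rfl fun f _ => by ring

theorem form_const_right (s c : ℝ) (x : I → ℝ) :
    form a b h s x (fun _ => c) = -(s ^ 2 * c * meanForm a b h s x) := by
  simp only [form, meanForm_apply, Finset.mul_sum, ← Finset.sum_neg_distrib]
  exact Finset.sum_congr rfl fun f _ => by ring

theorem meanForm_const (s c : ℝ) :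
    meanForm a b h s (fun _ => c) = c * totalMass h s := by
  simp only [meanForm_apply, totalMass, Finset.mul_sum]
  exact Finset.sum_congr rfl fun f _ => by ring

theorem reducedForm_comm (s : ℝ) (x y : I → ℝ) :
    reducedForm a b h s x y = reducedForm a b h s y x := by
  rw [reducedForm, reducedForm, form_comm]; ring

theorem reducedForm_add_smul_left (s t : ℝ) (x y z : I → ℝ) :
    reducedForm a b h s (x + t • y) z =
      reducedForm a b h s x z + t * reducedForm a b h s y z := by
  simp only [reducedForm, form_add_smul_left, map_add, map_smul, smul_eq_mul]
  ring

theorem reducedForm_add_smul (s t : ℝ) (x y : I → ℝ) :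
    reducedForm a b h s (x + t • y) (x + t • y) = reducedForm a b h s x x +
      2 * t * reducedForm a b h s x y + t ^ 2 * reducedForm a b h s y y := by
  rw [reducedForm_add_smul_left, reducedForm_comm s x, reducedForm_comm s y,
    reducedForm_add_smul_left, reducedForm_add_smul_left, reducedForm_comm s y x]
  ring

variable {S : ℝ} (hh : ∀ f, 0 < h f) (hS : ∀ f, S * h f < π)

include hh hS in
theorem totalMass_pos [Nonempty F] {s : ℝ} (hs : s ∈ Set.Icc 0 S) : 0 < totalMass h s :=
  Finset.sum_pos (fun f _ => mul_pos two_pos (massWeight_pos (hh f) hs.1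
    ((mul_le_mul_of_nonneg_right hs.2 (hh f).le).trans_lt (hS f)))) Finset.univ_nonempty

theorem continuous_sinc_mul (c : ℝ) : Continuous fun s : ℝ => sinc (s * c) :=
  continuous_sinc.comp (by fun_prop)

include hh hS in
theorem continuousOn_reducedForm [Nonempty F] :
    ContinuousOn (fun p : ℝ × (I → ℝ) => reducedForm a b h p.1 p.2 p.2)
      (Set.Icc 0 S ×ˢ Set.univ) := by
  have hmw : ∀ f, ContinuousOn (fun p : ℝ × (I → ℝ) => massWeight p.1 (h f))
      (Set.Icc 0 S ×ˢ Set.univ) := fun f =>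
    (continuousOn_massWeight (hh f) (hS f)).comp continuous_fst.continuousOn fun p hp => hp.1
  have hx : ∀ i, ContinuousOn (fun p : ℝ × (I → ℝ) => p.2 i) (Set.Icc 0 S ×ˢ Set.univ) :=
    fun i => by fun_prop
  have hm : ContinuousOn (fun p : ℝ × (I → ℝ) => meanForm a b h p.1 p.2)
      (Set.Icc 0 S ×ˢ Set.univ) := by
    simp only [meanForm_apply]
    exact continuousOn_finsetSum _ fun f _ => (hmw f).mul ((hx _).add (hx _))
  have hs : ContinuousOn (fun p : ℝ × (I → ℝ) => p.1) (Set.Icc 0 S ×ˢ Set.univ) := by fun_prop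
  unfold reducedForm
  refine ContinuousOn.add ?_ (ContinuousOn.div ((hs.pow 2).mul (hm.mul hm)) ?_ ?_)
  · refine continuousOn_finsetSum _ fun f _ => ContinuousOn.sub (ContinuousOn.div
      (((hx _).sub (hx _)).mul ((hx _).sub (hx _))) ?_ ?_)
      (((hs.pow 2).mul (hmw f)).mul (((hx _).mul (hx _)).add ((hx _).mul (hx _))))
    · exact (continuous_const.mul ((continuous_sinc_mul (h f)).comp continuous_fst)).continuousOn
    · intro p hp
      have h1 : p.1 * h f < π := (mul_le_mul_of_nonneg_right hp.1.2 (hh f).le).trans_lt (hS f)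
      exact (mul_pos (hh f) (sinc_pos (mul_nonneg hp.1.1 (hh f).le) h1)).ne'
  · exact continuousOn_finsetSum _ fun f _ => continuousOn_const.mul (hmw f)
  · intro p hp
    exact (totalMass_pos hh hS hp.1).ne'

include hh hS in
/-- The smallest positive frequency of a connected network. -/
theorem exists_min_frequency [Finite I] [Nonempty F] (hS0 : 0 ≤ S) (i₀ : I)
    (hconn : ∀ x : I → ℝ, (∀ f, x (a f) = x (b f)) → x i₀ = 0 → x = 0)
    (Z : Submodule ℝ (I → ℝ)) (hZ : 2 ≤ Module.finrank ℝ Z) (hZ₀ : ∀ z ∈ Z, z i₀ = 0)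
    (hZS : ∀ z ∈ Z, form a b h S z z ≤ 0) :
    ∃ s, 0 < s ∧ s ≤ S ∧ (∃ x : I → ℝ, x ≠ 0 ∧ ∀ y, form a b h s x y = 0) ∧
      ∀ s', 0 < s' → s' < s → ∀ x : I → ℝ, (∀ y, form a b h s' x y = 0) → x = 0 := by
  classical
  have := Fintype.ofFinite I
  have hScale : ∀ s c (x : I → ℝ), reducedForm a b h s (c • x) (c • x) =
      c ^ 2 * reducedForm a b h s x x := by
    intro s c x
    have h0 : reducedForm a b h s (0 + c • x) (0 + c • x) = _ := reducedForm_add_smul s c 0 x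
    have h1 : ∀ y, reducedForm a b h s 0 y = 0 := fun y => by simp [reducedForm, form]
    simpa [h1] using h0
  -- `reducedForm` is the maximum of the form over translates of `x` by constants, hence translation
  -- invariant, and normalizing `x i₀ = 0` loses nothing. The frequency sought is the least `s` at
  -- which it fails to be positive definite.
  let K : Set (ℝ × (I → ℝ)) := (Set.Icc 0 S ×ˢ (Metric.sphere 0 1 ∩ {x | x i₀ = 0})) ∩
    {p | reducedForm a b h p.1 p.2 p.2 ≤ 0}
  have hcpt : IsCompact (Set.Icc 0 S ×ˢ (Metric.sphere (0 : I → ℝ) 1 ∩ {x | x i₀ = 0})) :=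
    isCompact_Icc.prod ((isCompact_sphere _ _).inter_right
      (isClosed_eq (continuous_apply i₀) continuous_const))
  have hcont : ContinuousOn (fun p : ℝ × (I → ℝ) => reducedForm a b h p.1 p.2 p.2)
      (Set.Icc 0 S ×ˢ Set.univ) := continuousOn_reducedForm hh hS
  have hK : IsCompact K := by
    refine hcpt.of_isClosed_subset ?_ Set.inter_subset_left
    exact (hcont.mono (Set.prod_mono_right (Set.subset_univ _))).preimage_isClosed_of_isClosed
      hcpt.isClosed isClosed_Iic
  have hmemK : ∀ s ∈ Set.Icc 0 S, ∀ x : I → ℝ, x ≠ 0 → x i₀ = 0 → reducedForm a b h s x x ≤ 0 →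
      (s, ‖x‖⁻¹ • x) ∈ K := by
    intro s hs x hx hx0 hP
    refine ⟨⟨hs, ?_, ?_⟩, ?_⟩
    · simp [norm_smul, norm_ne_zero_iff.2 hx]
    · simp [hx0]
    · change reducedForm a b h s (‖x‖⁻¹ • x) (‖x‖⁻¹ • x) ≤ 0
      rw [hScale]
      exact mul_nonpos_of_nonneg_of_nonpos (sq_nonneg _) hP
  have hne : K.Nonempty := by
    -- On mean-zero vectors both forms agree; this condition is why two dimensions are needed.
    have h1 := finrank_le_inf_ker Z (meanForm a b h S)
    have h2 : 0 < Module.finrank ℝ (Z ⊓ LinearMap.ker (meanForm a b h S) : Submodule ℝ (I → ℝ)) := by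
      omega
    obtain ⟨⟨z, hz⟩, hz0⟩ := Module.finrank_pos_iff_exists_ne_zero.1 h2
    refine ⟨_, hmemK S ⟨hS0, le_rfl⟩ z (by simpa using hz0) (hZ₀ z hz.1) ?_⟩
    have h3 : meanForm a b h S z = 0 := hz.2
    simpa [reducedForm, h3] using hZS z hz.1
  obtain ⟨⟨s, x⟩, ⟨⟨hs, hx1, hx0⟩, hP⟩, hmin⟩ := hK.exists_isMinOn hne continuous_fst.continuousOn
  have hs' : s ∈ Set.Icc 0 S := hs
  have hx0' : x i₀ = 0 := hx0
  have hxne : x ≠ 0 := by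
    rintro rfl
    simp at hx1
  have hP' : reducedForm a b h s x x ≤ 0 := hP
  have hlt : ∀ s', 0 ≤ s' → s' < s → ∀ y : I → ℝ, y ≠ 0 → y i₀ = 0 →
      0 < reducedForm a b h s' y y := by
    intro s' h0 h1 y hy hy0
    by_contra! hcon
    have : s ≤ s' := hmin (hmemK s' ⟨h0, h1.le.trans hs'.2⟩ y hy hy0 hcon)
    linarith
  have hspos : 0 < s := by
    refine hs'.1.lt_of_ne ?_
    rintro rfl
    apply hxne
    refine hconn x ?_ hx0'
    have h1 : reducedForm a b h 0 x x = ∑ f, (x (a f) - x (b f)) ^ 2 / h f := by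
      simp [reducedForm, form, sq]
    rw [h1] at hP'
    have h2 : ∀ f ∈ Finset.univ, 0 ≤ (x (a f) - x (b f)) ^ 2 / h f := fun f _ =>
      div_nonneg (sq_nonneg _) (hh f).le
    have h3 := (Finset.sum_eq_zero_iff_of_nonneg h2).1 (le_antisymm hP' (Finset.sum_nonneg h2))
    intro f
    have h4 := h3 f (Finset.mem_univ f)
    rw [div_eq_zero_iff, or_iff_left (hh f).ne', sq_eq_zero_iff] at h4
    linarith
  -- Semidefiniteness at `s` is the limit of positivity below `s`.
  have hnonneg : ∀ y : I → ℝ, y i₀ = 0 → 0 ≤ reducedForm a b h s y y := by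
    intro y hy0
    rcases eq_or_ne y 0 with rfl | hy
    · simp [reducedForm, form]
    have hc : ContinuousWithinAt (fun t => reducedForm a b h t y y) (Set.Icc 0 S) s :=
      ContinuousWithinAt.comp (t := Set.Icc 0 S ×ˢ Set.univ) (f := fun t : ℝ => (t, y))
        (hcont (s, y) ⟨hs', trivial⟩) (by fun_prop) fun t ht => ⟨ht, trivial⟩
    have hc2 := (hc.mono (s := Set.Ico 0 s) fun t ht => ⟨ht.1, ht.2.le.trans hs'.2⟩)
    have : (nhdsWithin s (Set.Ico 0 s)).NeBot := by
      rw [← mem_closure_iff_nhdsWithin_neBot, closure_Ico hspos.ne]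
      exact ⟨hspos.le, le_rfl⟩
    refine ge_of_tendsto hc2 ?_
    filter_upwards [self_mem_nhdsWithin] with t ht
    exact (hlt t ht.1 ht.2 y hy hy0).le
  have hT := totalMass_pos hh hS hs'
  have hker : ∀ y : I → ℝ, y i₀ = 0 → reducedForm a b h s x y = 0 := by
    intro y hy0
    have hC := hnonneg y hy0
    set C := reducedForm a b h s y y
    set B := reducedForm a b h s x y with hB
    -- A null vector of a semidefinite form lies in its kernel. The denominator `C + 1` allows `C =
    -- 0`.
    have h1 := hnonneg (x + (-B / (C + 1)) • y) (by simp [hx0', hy0])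
    rw [reducedForm_add_smul, ← hB] at h1
    have h2 : 0 ≤ 2 * (-B / (C + 1)) * B + (-B / (C + 1)) ^ 2 * C := by linarith
    have h3 : 2 * (-B / (C + 1)) * B + (-B / (C + 1)) ^ 2 * C =
        -(B ^ 2 * (C + 2)) / (C + 1) ^ 2 := by
      field_simp; ring
    rw [h3, le_div_iff₀ (by positivity)] at h2
    have h4 : 0 ≤ B ^ 2 * C := by positivity
    nlinarith [sq_nonneg B]
  refine ⟨s, hspos, hs'.2, ?_, ?_⟩
  -- Subtracting the mean turns a kernel vector of the reduced form into one of the form itself.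
  · set c := meanForm a b h s x / totalMass h s with hc
    refine ⟨x + (-c) • fun _ => 1, ?_, ?_⟩
    · intro h0
      have h1 : ∀ i, x i = c := fun i => by
        have := congrFun h0 i
        simp at this
        linarith
      have h2 : c = 0 := by rw [← h1 i₀, hx0']
      exact hxne (funext fun i => by rw [h1 i, h2]; rfl)
    · have key : ∀ y, form a b h s (x + (-c) • fun _ => 1) y = reducedForm a b h s x y := by
        intro y
        rw [form_add_smul_left, form_comm s (fun _ => 1), form_const_right, reducedForm, hc]
        ring
      intro y
      rw [key]
      have h1 : reducedForm a b h s x (fun _ => 1) = 0 := by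
        rw [reducedForm, form_const_right, meanForm_const]
        field_simp
        ring
      have h2 := hker (y + (-(y i₀)) • fun _ => 1) (by simp)
      rw [reducedForm_comm, reducedForm_add_smul_left, reducedForm_comm s _ x,
        reducedForm_comm s _ x, h1] at h2
      linarith
  · intro s' h0 h1 y hy
    have hm : meanForm a b h s' y = 0 := by
      have := hy (fun _ => 1)
      rw [form_const_right] at this
      have h2 : s' ^ 2 ≠ 0 := by positivity
      simpa [h2, h0.ne'] using this
    have hT' := totalMass_pos hh hS (s := s') ⟨h0.le, h1.le.trans hs'.2⟩
    have key : ∀ c : ℝ, reducedForm a b h s' (y + c • fun _ => 1) (y + c • fun _ => 1) = 0 := by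
      intro c
      have e1 : reducedForm a b h s' y y = 0 := by simp [reducedForm, hy, hm]
      have e2 : reducedForm a b h s' y (fun _ => 1) = 0 := by simp [reducedForm, hy, hm]
      have e3 : reducedForm a b h s' (fun _ => 1) (fun _ => 1) = 0 := by
        rw [reducedForm, form_const_right, meanForm_const]
        field_simp
        ring
      rw [reducedForm_add_smul, e1, e2, e3]
      ring
    by_contra hyne
    have h3 : y + (-(y i₀)) • (fun _ => (1 : ℝ)) = 0 := by
      by_contra h4
      exact (hlt s' h0.le h1 _ h4 (by simp)).ne' (key _)
    have h4 : y = fun _ => y i₀ := funext fun i => by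
      have := congrFun h3 i
      simp at this
      linarith
    rw [h4, meanForm_const] at hm
    have h5 : y i₀ = 0 := by simpa [hT'.ne'] using hm
    exact hyne (by rw [h4, h5]; rfl)

end Network

end

section

/-! ### Solutions of the eigenvalue equation on an edge -/

theorem eq_of_hasDerivWithinAt_zero {f : ℝ → ℝ} {b : ℝ}
    (hf : ∀ t ∈ Set.Icc 0 b, HasDerivWithinAt f 0 (Set.Icc 0 b) t) :
    ∀ t ∈ Set.Icc 0 b, f t = f 0 := by
  refine constant_of_has_deriv_right_zero (fun t ht => (hf t ht).continuousWithinAt) ?_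
  intro t ht
  exact (hf t ⟨ht.1, ht.2.le⟩).mono_of_mem_nhdsWithin
    (Filter.mem_of_superset (Icc_mem_nhdsGE ht.2) (Set.Icc_subset_Icc_left ht.1))

/-- Rotating `(f, g / s)` back by the angle `s * t` gives two quantities with zero derivative. -/
theorem sinusoid_of_hasDerivWithinAt {f g : ℝ → ℝ} {s b : ℝ} (hs : s ≠ 0)
    (hf : ∀ t ∈ Set.Icc 0 b, HasDerivWithinAt f (g t) (Set.Icc 0 b) t)
    (hg : ∀ t ∈ Set.Icc 0 b, HasDerivWithinAt g (-(s ^ 2 * f t)) (Set.Icc 0 b) t) :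
    ∀ t ∈ Set.Icc 0 b, f t = f 0 * cos (s * t) + g 0 / s * sin (s * t) ∧
      g t = s * (-(f 0 * sin (s * t)) + g 0 / s * cos (s * t)) := by
  have hcos : ∀ t, HasDerivWithinAt (fun t => cos (s * t)) (-(s * sin (s * t))) (Set.Icc 0 b) t := by
    intro t
    have := ((hasDerivAt_id t).const_mul s).cos.hasDerivWithinAt (s := Set.Icc 0 b)
    simpa [mul_comm] using this
  have hsin : ∀ t, HasDerivWithinAt (fun t => sin (s * t)) (s * cos (s * t)) (Set.Icc 0 b) t := by
    intro t
    have := ((hasDerivAt_id t).const_mul s).sin.hasDerivWithinAt (s := Set.Icc 0 b)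
    simpa [mul_comm] using this
  have hu := eq_of_hasDerivWithinAt_zero
    (f := fun t => f t * cos (s * t) - g t * sin (s * t) / s) (b := b) fun t ht => by
      refine (((hf t ht).mul (hcos t)).sub (((hg t ht).mul (hsin t)).div_const s)).congr_deriv ?_
      field_simp
      ring
  have hv := eq_of_hasDerivWithinAt_zero
    (f := fun t => f t * sin (s * t) * s + g t * cos (s * t)) (b := b) fun t ht => by
      refine ((((hf t ht).mul (hsin t)).mul_const s).add ((hg t ht).mul (hcos t))).congr_deriv ?_
      ring
  intro t ht
  have h1 := hu t ht
  have h2 := hv t ht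
  simp only [mul_zero, cos_zero, sin_zero, mul_one, zero_div, sub_zero, zero_mul, zero_add]
    at h1 h2
  have h3 := sin_sq_add_cos_sq (s * t)
  constructor
  · rw [← h1, ← h2]
    field_simp
    linear_combination (-(f t * s)) * h3
  · rw [← h1, ← h2]
    field_simp
    linear_combination (-(g t)) * h3

/-! ### Subdivisions -/

universe u v
variable {α : Type u} {β : Type v} (G : Graph α β)

/-- The nodes of the subdivision of `G` which has `n` new vertices on each edge. -/
abbrev Node (n : ℕ) : Type (max u v) := V(G) ⊕ (E(G) × Fin n)

variable {G}

/-- The `k`-th node on the edge `e`. -/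
def node (n : ℕ) (e : E(G)) (k : ℕ) : Node G n :=
  if k = 0 then Sum.inl ⟨tail G e, (isLink_tail_head G e).left_mem⟩
  else if h : k - 1 < n then Sum.inr (e, ⟨k - 1, h⟩)
  else Sum.inl ⟨head G e, (isLink_tail_head G e).right_mem⟩

theorem node_zero (n : ℕ) (e : E(G)) :
    node n e 0 = Sum.inl ⟨tail G e, (isLink_tail_head G e).left_mem⟩ := rfl

theorem node_succ (n : ℕ) (e : E(G)) (i : Fin n) : node n e (i + 1) = Sum.inr (e, i) := by
  simp [node]

theorem node_last (n : ℕ) (e : E(G)) :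
    node n e (n + 1) = Sum.inl ⟨head G e, (isLink_tail_head G e).right_mem⟩ := by
  simp [node]

/-- The energy form of the subdivision. -/
def subdivForm [Fintype E(G)] (n : ℕ) (ℓ : E(G) → ℝ) (s : ℝ) (x y : Node G n → ℝ) : ℝ :=
  form (F := E(G) × Fin (n + 1)) (fun p => node n p.1 p.2) (fun p => node n p.1 (p.2 + 1))
    (fun p => ℓ p.1 / (n + 1)) s x y

/-! ### Kernel of the discrete form and eigenfunctions. -/

section Forms

variable [Fintype E(G)] {n : ℕ} {ℓ : E(G) → ℝ} {s : ℝ}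

theorem subdivForm_eq (hs : 0 < s) (hℓ : ∀ e, 0 < ℓ e) (hsℓ : ∀ e, s * (ℓ e / (n + 1)) < π)
    (x y : Node G n → ℝ) :
    subdivForm n ℓ s x y = ∑ e, ∑ k ∈ Finset.range (n + 1), s *
      ((cos (s * (ℓ e / (n + 1))) *
        (x (node n e k) * y (node n e k) + x (node n e (k + 1)) * y (node n e (k + 1))) -
        x (node n e k) * y (node n e (k + 1)) - x (node n e (k + 1)) * y (node n e k)) /
      sin (s * (ℓ e / (n + 1)))) := by
  rw [subdivForm, form, Fintype.sum_prod_type]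
  refine Finset.sum_congr rfl fun e _ => ?_
  rw [Finset.sum_range]
  refine Finset.sum_congr rfl fun k _ => ?_
  have := hℓ e
  exact form_term (by positivity) (hsℓ e) _ _ _ _

/-- Green's formula: for a sinusoidal `x`, the sum over the pieces of an edge telescopes to `y * x'`
at its ends. -/
theorem subdivForm_eq_boundary (hs : 0 < s) (hℓ : ∀ e, 0 < ℓ e)
    (hsℓ : ∀ e, s * (ℓ e / (n + 1)) < π) (x y : Node G n → ℝ) (A B : E(G) → ℝ)
    (hx : ∀ e, ∀ k ≤ n + 1, x (node n e k) =
      A e * cos (k * (s * (ℓ e / (n + 1)))) + B e * sin (k * (s * (ℓ e / (n + 1))))) :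
    subdivForm n ℓ s x y = ∑ e,
      (y (node n e (n + 1)) * (s * (-(A e * sin (s * ℓ e)) + B e * cos (s * ℓ e))) -
        y (node n e 0) * (s * B e)) := by
  rw [subdivForm_eq hs hℓ hsℓ]
  refine Finset.sum_congr rfl fun e _ => ?_
  set θ := s * (ℓ e / (n + 1)) with hθ
  have hpos : 0 < θ := by have := hℓ e; positivity
  have hsin : sin θ ≠ 0 := (sin_pos_of_pos_of_lt_pi hpos (hsℓ e)).ne'
  have hlast : s * ℓ e = ((n + 1 : ℕ) : ℝ) * θ := by
    rw [hθ]; push_cast; field_simp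
  let g : ℕ → ℝ := fun k =>
    y (node n e k) * (s * (-(A e * sin (k * θ)) + B e * cos (k * θ)))
  have h0 : y (node n e 0) * (s * B e) = g 0 := by simp [g]
  rw [hlast, h0]
  change _ = g (n + 1) - g 0
  rw [← Finset.sum_range_sub]
  refine Finset.sum_congr rfl fun k hk => ?_
  have hk' : k < n + 1 := Finset.mem_range.1 hk
  have e1 := hx e k hk'.le
  have e2 := hx e (k + 1) hk'
  have e3 : ((k + 1 : ℕ) : ℝ) * θ = k * θ + θ := by push_cast; ring
  simp only [g]
  rw [← hθ] at e1 e2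
  rw [e3] at e2 ⊢
  rw [e1, e2, sin_add, cos_add]
  field_simp
  have h4 : cos θ ^ 2 = 1 - sin θ ^ 2 := by rw [← sin_sq_add_cos_sq θ]; ring
  ring_nf
  simp only [h4]
  ring_nf

open Classical in
theorem sum_vertex_flux [Fintype V(G)] (w : V(G) → ℝ) (P Q : E(G) → ℝ) :
    ∑ e, (w ⟨head G e, (isLink_tail_head G e).right_mem⟩ * P e -
      w ⟨tail G e, (isLink_tail_head G e).left_mem⟩ * Q e) =
    -∑ v : V(G), w v * ∑ e : E(G),
      ((if tail G e = v then Q e else 0) + (if head G e = v then -P e else 0)) := by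
  simp only [Finset.mul_sum, mul_add, mul_ite, mul_zero]
  rw [Finset.sum_comm, ← Finset.sum_neg_distrib]
  refine Finset.sum_congr rfl fun e _ => ?_
  rw [Finset.sum_add_distrib]
  have h1 : ∀ v : V(G), (tail G e = v) ↔
      (⟨tail G e, (isLink_tail_head G e).left_mem⟩ : V(G)) = v := fun v => by
    rw [Subtype.ext_iff]
  have h2 : ∀ v : V(G), (head G e = v) ↔
      (⟨head G e, (isLink_tail_head G e).right_mem⟩ : V(G)) = v := fun v => by
    rw [Subtype.ext_iff]
  simp only [h1, h2, Finset.sum_ite_eq, Finset.mem_univ, if_true]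
  ring

/-- A solution of the Neumann problem restricts to a vector in the kernel of the energy form. -/
theorem exists_ker_of_solves [Finite V(G)] (hs : 0 < s) (hℓ : ∀ e, 0 < ℓ e)
    (hsℓ : ∀ e, s * (ℓ e / (n + 1)) < π) {f : E(G) → ℝ → ℝ}
    (hf : SolvesNeumannProblem G ℓ (s ^ 2) f) :
    ∃ x : Node G n → ℝ, (∀ y, subdivForm n ℓ s x y = 0) ∧ (x = 0 → f = 0) := by
  have := Fintype.ofFinite V(G)
  obtain ⟨hsupp, val, df, hval, hd, hdd, hflux⟩ := hf
  have hsol := fun e => sinusoid_of_hasDerivWithinAt hs.ne' (hd e) (hdd e)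
  let x : Node G n → ℝ := Sum.elim (fun v => val v) fun p => f p.1 ((p.2 + 1) * (ℓ p.1 / (n + 1)))
  have hx0 : ∀ e, ∀ k ≤ n + 1, x (node n e k) = f e (k * (ℓ e / (n + 1))) := by
    intro e k hk
    rcases k with _ | k
    · simp [node_zero, x, (hval e).1]
    · rcases (Nat.lt_succ_iff.1 hk).eq_or_lt with rfl | hk
      · rw [node_last]
        simp only [x, Sum.elim_inl, ← (hval e).2]
        congr 1
        push_cast
        field_simp
      · have := node_succ n e ⟨k, hk⟩
        simp only at this
        rw [this]
        simp [x]
  have hx : ∀ e, ∀ k ≤ n + 1, x (node n e k) = f e 0 * cos (k * (s * (ℓ e / (n + 1)))) +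
      df e 0 / s * sin (k * (s * (ℓ e / (n + 1)))) := by
    intro e k hk
    have h1 : (k : ℝ) * (ℓ e / (n + 1)) ∈ Set.Icc 0 (ℓ e) := by
      have := hℓ e
      refine ⟨by positivity, ?_⟩
      have h2 : (k : ℝ) ≤ n + 1 := by exact_mod_cast hk
      calc (k : ℝ) * (ℓ e / (n + 1)) ≤ (n + 1) * (ℓ e / (n + 1)) := by gcongr
        _ = ℓ e := by field_simp
    rw [hx0 e k hk, (hsol e _ h1).1, show s * (k * (ℓ e / (n + 1))) = k * (s * (ℓ e / (n + 1))) by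
      ring]
  refine ⟨x, fun y => ?_, fun hx00 => ?_⟩
  · rw [subdivForm_eq_boundary hs hℓ hsℓ x y (fun e => f e 0) (fun e => df e 0 / s) hx]
    have h1 : ∀ e, s * (-(f e 0 * sin (s * ℓ e)) + df e 0 / s * cos (s * ℓ e)) = df e (ℓ e) :=
      fun e => ((hsol e _ ⟨(hℓ e).le, le_rfl⟩).2).symm
    have h2 : ∀ e, s * (df e 0 / s) = df e 0 := fun e => by field_simp
    simp only [h1, h2, node_zero, node_last]
    rw [sum_vertex_flux (fun v => y (Sum.inl v)) (fun e => df e (ℓ e)) (fun e => df e 0)]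
    rw [neg_eq_zero]
    refine Finset.sum_eq_zero fun v _ => ?_
    rw [hflux v v.2, mul_zero]
  · funext e t
    by_cases ht : t ∈ Set.Icc 0 (ℓ e)
    -- A sinusoid vanishing at two nodes less than half a wave apart is zero.
    · have h1 := hx e 0 (by omega)
      have h2 := hx e 1 (by omega)
      rw [hx00] at h1 h2
      simp only [Pi.zero_apply, Nat.cast_zero, zero_mul, cos_zero, sin_zero, mul_zero, mul_one,
        add_zero, Nat.cast_one, one_mul] at h1 h2
      rw [← h1, zero_mul, zero_add] at h2
      have hpos : 0 < s * (ℓ e / (n + 1)) := by have := hℓ e; positivity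
      have h3 := (mul_eq_zero.1 h2.symm).resolve_right
        (sin_pos_of_pos_of_lt_pi hpos (hsℓ e)).ne'
      rw [(hsol e t ht).1, ← h1, h3]
      simp
    · exact hsupp e t ht

/-- A vector in the kernel of the energy form extends to a solution of the Neumann problem. -/
theorem exists_solves_of_ker (hs : 0 < s) (hℓ : ∀ e, 0 < ℓ e)
    (hsℓ : ∀ e, s * (ℓ e / (n + 1)) < π) (hcover : ∀ v ∈ V(G), ∃ e, tail G e = v ∨ head G e = v)
    [Finite V(G)]
    {x : Node G n → ℝ} (hx0 : x ≠ 0) (hx : ∀ y, subdivForm n ℓ s x y = 0) :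
    ∃ f, f ≠ 0 ∧ SolvesNeumannProblem G ℓ (s ^ 2) f := by
  classical
  have := Fintype.ofFinite V(G)
  have hrec : ∀ e, ∀ i, i < n → x (node n e i) + x (node n e (i + 2)) =
      2 * cos (s * (ℓ e / (n + 1))) * x (node n e (i + 1)) := by
    intro e i hi
    set θ := s * (ℓ e / (n + 1)) with hθ
    have hpos : 0 < θ := by have := hℓ e; positivity
    have hsin : sin θ ≠ 0 := (sin_pos_of_pos_of_lt_pi hpos (hsℓ e)).ne'
    -- Testing against the delta at an interior node gives the three-term recurrence, whose
    -- solutions are sampled sinusoids.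
    have h1 := hx (Pi.single (node n e (i + 1)) 1)
    have hnode : node n e (i + 1) = Sum.inr (e, ⟨i, hi⟩) := node_succ n e ⟨i, hi⟩
    have hy : ∀ e' k, k ≤ n + 1 → (Pi.single (node n e (i + 1)) 1 : Node G n → ℝ) (node n e' k) =
        if e' = e ∧ k = i + 1 then 1 else 0 := by
      intro e' k hk
      rw [hnode, Pi.single_apply]
      congr 1
      apply propext
      rcases k with _ | k
      · simp [node_zero]
      · rcases (Nat.lt_succ_iff.1 hk).eq_or_lt with rfl | hk
        · rw [node_last]; simp; omega
        · rw [show node n e' (k + 1) = Sum.inr (e', ⟨k, hk⟩) from node_succ n e' ⟨k, hk⟩]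
          simp
    rw [subdivForm_eq hs hℓ hsℓ, Finset.sum_eq_single e, Finset.sum_eq_add i (i + 1)] at h1
    · rw [hy e i (by omega), hy e (i + 1) (by omega), hy e (i + 2) (by omega)] at h1
      simp only [Nat.left_eq_add, one_ne_zero, and_false, if_false, and_self, if_true, mul_zero,
        mul_one, zero_add, add_zero, sub_zero, add_right_inj,
        OfNat.ofNat_ne_one] at h1
      rw [← hθ] at h1
      field_simp at h1
      rw [mul_zero] at h1
      have := (mul_eq_zero.1 h1).resolve_left hs.ne'
      linarith
    · omega
    · intro k hk hne
      have hk' : k < n + 1 := Finset.mem_range.1 hk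
      rw [hy e k (by omega), hy e (k + 1) (by omega), if_neg, if_neg]
      · simp
      · omega
      · omega
    · intro h; exact absurd (Finset.mem_range.2 (by omega)) h
    · intro h; exact absurd (Finset.mem_range.2 (by omega)) h
    · intro e' _ hne
      refine Finset.sum_eq_zero fun k hk => ?_
      have hk' : k < n + 1 := Finset.mem_range.1 hk
      rw [hy e' k (by omega), hy e' (k + 1) (by omega), if_neg (by tauto), if_neg (by tauto)]
      simp
    · intro h; exact absurd (Finset.mem_univ _) h
  let A : E(G) → ℝ := fun e => x (node n e 0)
  let B : E(G) → ℝ := fun e => (x (node n e 1) - cos (s * (ℓ e / (n + 1))) * x (node n e 0)) /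
    sin (s * (ℓ e / (n + 1)))
  have hxk : ∀ e, ∀ k ≤ n + 1, x (node n e k) =
      A e * cos (k * (s * (ℓ e / (n + 1)))) + B e * sin (k * (s * (ℓ e / (n + 1)))) := by
    intro e k
    have hpos : 0 < s * (ℓ e / (n + 1)) := by have := hℓ e; positivity
    have hsin : sin (s * (ℓ e / (n + 1))) ≠ 0 := (sin_pos_of_pos_of_lt_pi hpos (hsℓ e)).ne'
    induction k using Nat.twoStepInduction with
    | zero => intro _; simp [A]
    | one => intro _; simp only [A, B, Nat.cast_one, one_mul]; rw [div_mul_cancel₀ _ hsin]; ring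
    | more k ih1 ih2 =>
      intro hk
      have h1 := hrec e k (by omega)
      rw [ih1 (by omega), ih2 (by omega)] at h1
      rw [eq_sub_of_add_eq' h1]
      generalize s * (ℓ e / (n + 1)) = θ
      have e1 : ((k + 1 : ℕ) : ℝ) * θ = k * θ + θ := by push_cast; ring
      have e2 : ((k + 2 : ℕ) : ℝ) * θ = k * θ + 2 * θ := by push_cast; ring
      rw [e1, e2, sin_add, cos_add, sin_add, cos_add, sin_two_mul, cos_two_mul]
      have h4 : sin θ ^ 2 = 1 - cos θ ^ 2 := by rw [← sin_sq_add_cos_sq θ]; ring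
      ring_nf
  let f : E(G) → ℝ → ℝ := fun e t =>
    if t ∈ Set.Icc 0 (ℓ e) then A e * cos (s * t) + B e * sin (s * t) else 0
  have hfin : ∀ e, ∀ t ∈ Set.Icc 0 (ℓ e), f e t = A e * cos (s * t) + B e * sin (s * t) :=
    fun e t ht => if_pos ht
  have hlast : ∀ e, s * ℓ e = ((n + 1 : ℕ) : ℝ) * (s * (ℓ e / (n + 1))) := by
    intro e; push_cast; field_simp
  refine ⟨f, ?_, fun e t ht => if_neg ht,
    fun v => if h : v ∈ V(G) then x (Sum.inl ⟨v, h⟩) else 0,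
    fun e t => s * (-(A e * sin (s * t)) + B e * cos (s * t)), ?_, ?_, ?_, ?_⟩
  · intro hf0
    apply hx0
    have hnode : ∀ e, ∀ k ≤ n + 1, x (node n e k) = 0 := by
      intro e k hk
      have h1 : (k : ℝ) * (ℓ e / (n + 1)) ∈ Set.Icc 0 (ℓ e) := by
        have := hℓ e
        refine ⟨by positivity, ?_⟩
        have h2 : (k : ℝ) ≤ n + 1 := by exact_mod_cast hk
        calc (k : ℝ) * (ℓ e / (n + 1)) ≤ (n + 1) * (ℓ e / (n + 1)) := by gcongr
          _ = ℓ e := by field_simp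
      have h2 := hfin e _ h1
      rw [hf0, show s * (k * (ℓ e / (n + 1))) = k * (s * (ℓ e / (n + 1))) by ring,
        ← hxk e k hk] at h2
      exact h2.symm
    funext i
    rcases i with ⟨v, hv⟩ | ⟨e, i⟩
    · obtain ⟨e, rfl | rfl⟩ := hcover v hv
      · exact hnode e 0 (by omega)
      · have := hnode e (n + 1) le_rfl
        rwa [node_last] at this
    · have := hnode e (i + 1) (by omega)
      rwa [node_succ] at this
  · intro e
    have ht : tail G e ∈ V(G) := (isLink_tail_head G e).left_mem
    have hh : head G e ∈ V(G) := (isLink_tail_head G e).right_mem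
    refine ⟨?_, ?_⟩
    · rw [hfin e 0 ⟨le_rfl, (hℓ e).le⟩]
      simp [A, node_zero, ht]
    · rw [hfin e (ℓ e) ⟨(hℓ e).le, le_rfl⟩, hlast e, ← hxk e (n + 1) le_rfl, node_last]
      simp [hh]
  · intro e t ht
    have h1 := (((hasDerivAt_id t).const_mul s).cos.const_mul (A e)).add
      (((hasDerivAt_id t).const_mul s).sin.const_mul (B e))
    refine HasDerivWithinAt.congr_of_mem (h1.hasDerivWithinAt.congr_deriv ?_) (hfin e) ht
    simp; ring
  · intro e t ht
    have h1 := (((((hasDerivAt_id t).const_mul s).sin.const_mul (A e)).neg).add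
      (((hasDerivAt_id t).const_mul s).cos.const_mul (B e))).const_mul s
    rw [hfin e t ht]
    refine h1.hasDerivWithinAt.congr_deriv ?_
    simp; ring
  · intro v hv
    have h1 := hx (Sum.elim (Pi.single ⟨v, hv⟩ 1) 0)
    rw [subdivForm_eq_boundary hs hℓ hsℓ x _ A B hxk] at h1
    simp only [node_zero, node_last, Sum.elim_inl] at h1
    rw [sum_vertex_flux, Finset.sum_eq_single ⟨v, hv⟩] at h1
    · simpa using h1
    · intro b _ hb
      simp [hb]
    · intro h; exact absurd (Finset.mem_univ _) h

end Forms

end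

section

universe u v
variable {α : Type u} {β : Type v} {G : Graph α β} {ℓ : E(G) → ℝ}

/-! ### Nonpositive eigenvalues and the definition of the first eigenvalue -/

/-- The constant function `1` on a metric graph. -/
def oneFun (G : Graph α β) (ℓ : E(G) → ℝ) (e : E(G)) : ℝ → ℝ :=
  (Set.Icc 0 (ℓ e)).indicator 1

theorem solves_oneFun [Fintype E(G)] (hℓ : IsMetric G ℓ) :
    SolvesNeumannProblem G ℓ 0 (oneFun G ℓ) := by
  have h1 : ∀ e, ∀ t ∈ Set.Icc 0 (ℓ e), oneFun G ℓ e t = 1 := fun e t ht => by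
    simp only [oneFun, Set.indicator_of_mem ht, Pi.one_apply]
  refine ⟨fun e t ht => by simp only [oneFun, Set.indicator_of_notMem ht], fun _ => 1,
    fun _ _ => 0, fun e => ⟨h1 e 0 ⟨le_rfl, (hℓ e).le⟩, h1 e _ ⟨(hℓ e).le, le_rfl⟩⟩, ?_, ?_, ?_⟩
  · intro e t ht
    exact (hasDerivWithinAt_const t _ (1 : ℝ)).congr_of_mem (h1 e) ht
  · intro e t ht
    simpa using hasDerivWithinAt_const t (Set.Icc 0 (ℓ e)) (0 : ℝ)
  · simp

theorem val_eq_of_connected {γ : Type*} (hconn : Connected G) {val : α → γ}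
    (h : ∀ e, val (head G e) = val (tail G e)) {x y : α} (hx : x ∈ V(G)) (hy : y ∈ V(G)) :
    val x = val y := by
  have h1 := hconn.2 x hx y hy
  induction h1 with
  | refl => rfl
  | @tail b c _ h2 ih =>
    rw [ih h2.left_mem]
    obtain ⟨e, he⟩ := h2
    have h3 := h ⟨e, he.edge_mem⟩
    rcases (isLink_tail_head G ⟨e, he.edge_mem⟩).eq_and_eq_or_eq_and_eq he with
      ⟨h1, h2⟩ | ⟨h1, h2⟩ <;> rw [h1, h2] at h3
    · exact h3.symm
    · exact h3

/-- For `ν ≤ 0` the product `f * f'` has derivative `f' ^ 2 - ν * f ^ 2 ≥ 0`, while its increments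
over the edges sum to zero by the vertex conditions. So `f' = 0`. -/
theorem eq_const_of_solves [Finite V(G)] [Fintype E(G)] (hconn : Connected G) (hℓ : IsMetric G ℓ)
    {ν : ℝ} (hν : ν ≤ 0) {f : E(G) → ℝ → ℝ} (hf : SolvesNeumannProblem G ℓ ν f) :
    ∃ c : ℝ, f = c • oneFun G ℓ := by
  have := Fintype.ofFinite V(G)
  obtain ⟨hsupp, val, df, hval, hd, hdd, hflux⟩ := hf
  have hΦ : ∀ e, ∀ t ∈ Set.Icc 0 (ℓ e), HasDerivWithinAt (fun t => f e t * df e t)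
      (df e t ^ 2 + -ν * f e t ^ 2) (Set.Icc 0 (ℓ e)) t := fun e t ht =>
    ((hd e t ht).mul (hdd e t ht)).congr_deriv (by ring)
  have hmono : ∀ e, MonotoneOn (fun t => f e t * df e t) (Set.Icc 0 (ℓ e)) := by
    intro e
    have hat : ∀ t ∈ interior (Set.Icc 0 (ℓ e)), HasDerivAt (fun t => f e t * df e t)
        (df e t ^ 2 + -ν * f e t ^ 2) t := fun t ht =>
      (hΦ e t (interior_subset ht)).hasDerivAt (mem_interior_iff_mem_nhds.1 ht)
    refine monotoneOn_of_deriv_nonneg (convex_Icc _ _)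
      (fun t ht => (hΦ e t ht).continuousWithinAt)
      (fun t ht => (hat t ht).differentiableAt.differentiableWithinAt) fun t ht => ?_
    rw [(hat t ht).deriv]
    have : 0 ≤ -ν * f e t ^ 2 := mul_nonneg (by linarith) (sq_nonneg _)
    positivity
  have hsum : ∑ e, (f e (ℓ e) * df e (ℓ e) - f e 0 * df e 0) = 0 := by
    have h1 := sum_vertex_flux (G := G) (fun v => val v) (fun e => df e (ℓ e)) (fun e => df e 0)
    simp only [← (hval _).1, ← (hval _).2] at h1
    rw [h1, neg_eq_zero]
    exact Finset.sum_eq_zero fun v _ => by rw [hflux v v.2, mul_zero]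
  have h0mem : ∀ e, (0 : ℝ) ∈ Set.Icc 0 (ℓ e) := fun e => ⟨le_rfl, (hℓ e).le⟩
  have hlmem : ∀ e, ℓ e ∈ Set.Icc 0 (ℓ e) := fun e => ⟨(hℓ e).le, le_rfl⟩
  have hnn : ∀ e ∈ Finset.univ, 0 ≤ f e (ℓ e) * df e (ℓ e) - f e 0 * df e 0 := fun e _ =>
    sub_nonneg.2 (hmono e (h0mem e) (hlmem e) (hℓ e).le)
  have hdf : ∀ e, ∀ t ∈ Set.Icc 0 (ℓ e), df e t = 0 := by
    intro e t ht
    have h1 := (Finset.sum_eq_zero_iff_of_nonneg hnn).1 hsum e (Finset.mem_univ e)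
    have hconst : ∀ t ∈ Set.Icc 0 (ℓ e), f e t * df e t = f e 0 * df e 0 := by
      intro t ht
      have h2 := hmono e (h0mem e) ht ht.1
      have h3 := hmono e ht (hlmem e) ht.2
      simp only at h2 h3
      linarith
    have h2 := (hasDerivWithinAt_const t (Set.Icc 0 (ℓ e)) (f e 0 * df e 0)).congr_of_mem hconst ht
    have h3 := (uniqueDiffOn_Icc (hℓ e) t ht).eq_deriv _ (hΦ e t ht) h2
    have : 0 ≤ -ν * f e t ^ 2 := mul_nonneg (by linarith) (sq_nonneg _)
    nlinarith [sq_nonneg (df e t)]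
  have hfc : ∀ e, ∀ t ∈ Set.Icc 0 (ℓ e), f e t = val (tail G e) := by
    intro e t ht
    rw [← (hval e).1]
    exact eq_of_hasDerivWithinAt_zero (fun t ht => by simpa [hdf e t ht] using hd e t ht) t ht
  obtain ⟨x₀, hx₀⟩ := hconn.1
  refine ⟨val x₀, funext fun e => funext fun t => ?_⟩
  by_cases ht : t ∈ Set.Icc 0 (ℓ e)
  · rw [hfc e t ht, val_eq_of_connected (val := val) hconn (fun e => ?_) (isLink_tail_head G e).left_mem hx₀]
    · simp [oneFun, Set.indicator_of_mem ht]
    · rw [← (hval e).2, hfc e _ (hlmem e)]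
  · rw [hsupp e t ht]
    simp [oneFun, Set.indicator_of_notMem ht]

/-- By `hmin`, only constants contribute below `s ^ 2`; the constant `1` and `f` are independent. -/
theorem isNthEigenvalue_one [Finite V(G)] [Fintype E(G)] (hconn : Connected G)
    (hedge : E(G).Nonempty) (hℓ : IsMetric G ℓ)
    {s : ℝ} (hs : 0 < s) {f : E(G) → ℝ → ℝ} (hf : f ≠ 0)
    (hsol : SolvesNeumannProblem G ℓ (s ^ 2) f)
    (hmin : ∀ s', 0 < s' → s' < s → ∀ g, SolvesNeumannProblem G ℓ (s' ^ 2) g → g = 0) :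
    IsNthEigenvalue G ℓ 1 (s ^ 2) := by
  constructor
  · have h1 : Submodule.span ℝ {f | ∃ ν < s ^ 2, SolvesNeumannProblem G ℓ ν f} ≤
        Submodule.span ℝ {oneFun G ℓ} := by
      rw [Submodule.span_le]
      rintro g ⟨ν, hν, hg⟩
      rcases le_or_gt ν 0 with h0 | h0
      · obtain ⟨c, rfl⟩ := eq_const_of_solves hconn hℓ h0 hg
        exact Submodule.smul_mem _ _ (Submodule.mem_span_singleton_self _)
      · rw [hmin (√ν) (sqrt_pos.2 h0) ((sqrt_lt' hs).2 hν) g (by rwa [sq_sqrt h0.le])]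
        exact Submodule.zero_mem _
    refine (Submodule.rank_mono h1).trans ?_
    simpa using rank_span_le (R := ℝ) {oneFun G ℓ}
  · have hli : LinearIndependent ℝ ![oneFun G ℓ, f] := by
      rw [LinearIndependent.pair_iff' ?_]
      · intro c hc
        apply hf
        obtain ⟨e₀, he₀⟩ := hedge
        obtain ⟨hsupp, val, df, hval, hd, hdd, hflux⟩ := hsol
        have hfc : ∀ e, ∀ t ∈ Set.Icc 0 (ℓ e), f e t = c := fun e t ht => by
          rw [← hc]; simp [oneFun, Set.indicator_of_mem ht]
        have hdf : ∀ e, ∀ t ∈ Set.Icc 0 (ℓ e), df e t = 0 := fun e t ht =>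
          (uniqueDiffOn_Icc (hℓ e) t ht).eq_deriv _ (hd e t ht)
            ((hasDerivWithinAt_const t _ c).congr_of_mem (hfc e) ht)
        have h0 : (0 : ℝ) ∈ Set.Icc 0 (ℓ ⟨e₀, he₀⟩) := ⟨le_rfl, (hℓ _).le⟩
        have h2 := (uniqueDiffOn_Icc (hℓ ⟨e₀, he₀⟩) 0 h0).eq_deriv _ (hdd _ 0 h0)
          ((hasDerivWithinAt_const 0 _ 0).congr_of_mem (hdf _) h0)
        rw [hfc _ _ h0] at h2
        have : c = 0 := by
          have := hs.ne'
          simpa [this] using h2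
        rw [← hc, this, zero_smul]
      · intro h
        obtain ⟨e₀, he₀⟩ := hedge
        have h1 := congrFun (congrFun h ⟨e₀, he₀⟩) 0
        have h0 : (0 : ℝ) ∈ Set.Icc 0 (ℓ ⟨e₀, he₀⟩) := ⟨le_rfl, (hℓ _).le⟩
        simp [oneFun, Set.indicator_of_mem h0] at h1
    set W := Submodule.span ℝ {f | ∃ ν ≤ s ^ 2, SolvesNeumannProblem G ℓ ν f} with hW
    have h1 : oneFun G ℓ ∈ W := Submodule.subset_span ⟨0, by positivity, solves_oneFun hℓ⟩
    have h2 : f ∈ W := Submodule.subset_span ⟨s ^ 2, le_rfl, hsol⟩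
    have h3 : LinearIndependent ℝ (![⟨oneFun G ℓ, h1⟩, ⟨f, h2⟩] : Fin 2 → W) := by
      refine LinearIndependent.of_comp W.subtype ?_
      convert hli using 1
      funext i
      fin_cases i <;> rfl
    have h4 := h3.cardinal_lift_le_rank
    simp only [Cardinal.mk_fin, Cardinal.lift_natCast] at h4
    have h5 : ((2 : ℕ) : Cardinal) ≤ Module.rank ℝ W := by simpa using h4
    rw [Nat.cast_one, one_add_one_eq_two]
    exact_mod_cast h5

theorem exists_solves_of_isNthEigenvalue_one [Finite V(G)] [Fintype E(G)] (hconn : Connected G)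
    (hℓ : IsMetric G ℓ) {μ : ℝ} (hμ : IsNthEigenvalue G ℓ 1 μ) :
    ∃ s, 0 < s ∧ s ^ 2 ≤ μ ∧ ∃ f, f ≠ 0 ∧ SolvesNeumannProblem G ℓ (s ^ 2) f := by
  by_contra! hcon
  have h1 : Submodule.span ℝ {f | ∃ ν ≤ μ, SolvesNeumannProblem G ℓ ν f} ≤
      Submodule.span ℝ {oneFun G ℓ} := by
    rw [Submodule.span_le]
    rintro g ⟨ν, hν, hg⟩
    rcases le_or_gt ν 0 with h0 | h0
    · obtain ⟨c, rfl⟩ := eq_const_of_solves hconn hℓ h0 hg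
      exact Submodule.smul_mem _ _ (Submodule.mem_span_singleton_self _)
    · have : g = 0 := by
        by_contra hg0
        exact hcon (√ν) (sqrt_pos.2 h0) (by rwa [sq_sqrt h0.le]) g hg0 (by rwa [sq_sqrt h0.le])
      rw [this]
      exact Submodule.zero_mem _
  have h2 := hμ.2.trans (Submodule.rank_mono h1)
  have h3 : Module.rank ℝ (Submodule.span ℝ {oneFun G ℓ}) ≤ 1 := by
    simpa using rank_span_le (R := ℝ) {oneFun G ℓ}
  have h4 := h2.trans h3
  norm_num at h4

end

section

/-! ### The upper bound -/

theorem chainEnergy_reverse (θ : ℝ) (N : ℕ) (x : ℕ → ℝ) :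
    chainEnergy θ N (fun k => x (N - k)) = chainEnergy θ N x := by
  unfold chainEnergy
  rw [← Finset.sum_range_reflect (fun k => segmentEnergy θ (x k) (x (k + 1)))]
  refine Finset.sum_congr rfl fun k hk => ?_
  have hk' := Finset.mem_range.1 hk
  beta_reduce
  rw [segmentEnergy_comm, show N - (k + 1) = N - 1 - k by omega,
    show N - k = N - 1 - k + 1 by omega]

universe u v
variable {α : Type u} {β : Type v} {G : Graph α β} {ℓ : E(G) → ℝ} {n : ℕ} {s : ℝ}

/-- The energy of a vector on an edge of the subdivision. -/
def edgeEnergy (n : ℕ) (ℓ : E(G) → ℝ) (s : ℝ) (e : E(G)) (z : Node G n → ℝ) : ℝ :=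
  chainEnergy (s * (ℓ e / (n + 1))) (n + 1) fun k => z (node n e k)

theorem subdivForm_self [Fintype E(G)] (hs : 0 < s) (hℓ : ∀ e, 0 < ℓ e) (hsℓ : ∀ e, s * (ℓ e / (n + 1)) < π)
    (z : Node G n → ℝ) : subdivForm n ℓ s z z = s * ∑ e, edgeEnergy n ℓ s e z := by
  rw [subdivForm_eq hs hℓ hsℓ, Finset.mul_sum]
  refine Finset.sum_congr rfl fun e _ => ?_
  rw [edgeEnergy, chainEnergy, Finset.mul_sum]
  refine Finset.sum_congr rfl fun k _ => ?_
  rw [segmentEnergy]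
  ring

open Classical in
/-- The value at a vertex. -/
def vertexValue (G : Graph α β) (n : ℕ) (v : α) : (Node G n → ℝ) →ₗ[ℝ] ℝ :=
  if h : v ∈ V(G) then LinearMap.proj (Sum.inl ⟨v, h⟩) else 0

/-- Elimination reads an edge from a prescribed end, whereas its tail is an arbitrary choice; the
energy is invariant under reversal. -/
theorem exists_chain {e : E(G)} {v w : α} (he : G.IsLink e.1 v w) (s : ℝ) (ℓ : E(G) → ℝ) :
    ∃ g : ℕ → (Node G n → ℝ) →ₗ[ℝ] ℝ, g 0 = vertexValue G n v ∧ g (n + 1) = vertexValue G n w ∧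
      ∀ z, chainEnergy (s * (ℓ e / (n + 1))) (n + 1) (fun k => g k z) = edgeEnergy n ℓ s e z := by
  have hl : (LinearMap.proj (node n e 0) : (Node G n → ℝ) →ₗ[ℝ] ℝ) = vertexValue G n (tail G e) := by
    rw [vertexValue, dif_pos (isLink_tail_head G e).left_mem, node_zero]
  have hr : (LinearMap.proj (node n e (n + 1)) : (Node G n → ℝ) →ₗ[ℝ] ℝ) =
      vertexValue G n (head G e) := by
    rw [vertexValue, dif_pos (isLink_tail_head G e).right_mem, node_last]
  rcases (isLink_tail_head G e).eq_and_eq_or_eq_and_eq he with ⟨h1, h2⟩ | ⟨h1, h2⟩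
  · exact ⟨fun k => LinearMap.proj (node n e k), by rw [← h1, ← hl], by rw [← h2, ← hr], fun z => rfl⟩
  · refine ⟨fun k => LinearMap.proj (node n e (n + 1 - k)), ?_, ?_, fun z => ?_⟩
    · rw [← h2, ← hr]; rfl
    · rw [← h1, ← hl, ← Nat.sub_self (n + 1)]
    · exact chainEnergy_reverse _ _ fun k => z (node n e k)

-- The phase count on the whole graph: each edge outside the spanning tree contributes `π`, every
-- edge `e` subtracts `s * ℓ e`, and positivity of the final phase at `v₀` forces two half-turns.
open Classical in
theorem exists_submodule_of_parent [Finite V(G)] [Fintype E(G)]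
    (hdeg : ∀ v ∈ V(G), ∀ e, ∃ e', e' ≠ e ∧ G.Inc e' v)
    {X : Set α} {v₀ r : α} (hv₀ : v₀ ∉ X) (hV : V(G) = insert v₀ X)
    {p : α → α} {pe : α → E(G)} {dep : α → ℕ} (hr : r ∈ X) (hpr : p r = v₀)
    (hp : ∀ v ∈ X, G.IsLink (pe v).1 v (p v) ∧ dep (p v) < dep v) (hinj : Set.InjOn pe X)
    (hleaf : ∀ e : E(G), e ∉ pe '' X → ∃ v ∈ X, G.IsLink e.1 v v₀)
    (hs : 0 < s) (hℓ : ∀ e, 0 < ℓ e) (hsℓ : ∀ e, s * (ℓ e / (n + 1)) < π)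
    (hL : (1 + (bettiNumber G : ℝ)) * π < s * length G ℓ) :
    ∃ Z : Submodule ℝ (Node G n → ℝ), 2 ≤ Module.finrank ℝ Z ∧
      (∀ z ∈ Z, vertexValue G n v₀ z = 0) ∧ ∀ z ∈ Z, subdivForm n ℓ s z z ≤ 0 := by
  have := Fintype.ofFinite V(G)
  have hVfin : V(G).Finite := Set.toFinite _
  have hXfin : X.Finite := hVfin.subset (by rw [hV]; exact Set.subset_insert _ _)
  set Xf := hXfin.toFinset with hXf
  set Bf := hVfin.toFinset with hBf
  have hmX : ∀ v, v ∈ Xf ↔ v ∈ X := fun v => hXfin.mem_toFinset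
  have hmB : ∀ v, v ∈ Bf ↔ v = v₀ ∨ v ∈ X := fun v => by
    rw [hBf, hVfin.mem_toFinset, hV]; exact Iff.rfl
  set T : Finset (E(G)) := Xf.image pe with hT
  have hmT : ∀ e, e ∉ T → e ∉ pe '' X := by
    rintro e he ⟨v, hv, rfl⟩
    exact he (Finset.mem_image_of_mem _ ((hmX v).2 hv))
  set θ : E(G) → ℝ := fun e => s * (ℓ e / (n + 1)) with hθ
  have hθ0 : ∀ e, 0 < θ e := fun e => by have := hℓ e; simp only [hθ]; positivity
  set m := Fintype.card E(G) with hm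
  set δ := s * length G ℓ - (1 + (bettiNumber G : ℝ)) * π with hδ
  have hδ0 : 0 < δ := by linarith
  -- Each of the `m * (n + 1)` pieces may cost `η`, and the total must stay below `δ`.
  set η := δ / (m * (n + 1) + 1) with hη
  have hη0 : 0 < η := by positivity
  set Z₀ : Submodule ℝ (Node G n → ℝ) := LinearMap.ker (vertexValue G n v₀) with hZ₀
  -- attach the edges outside the spanning tree
  have step1 : ∀ J : Finset E(G), Disjoint J T → ∃ P : Finset α,
      Reduces Z₀ (vertexValue G n) Bf P (fun z => ∑ e ∈ J, edgeEnergy n ℓ s e z)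
        (∑ e ∈ J, (π - (n + 1 : ℕ) * θ e + n * η)) (J.card * n) ∧
      ∀ e ∈ J, ∀ v ∈ X, G.IsLink e.1 v v₀ → v ∈ P := by
    intro J
    induction J using Finset.induction_on with
    | empty => intro _; exact ⟨∅, by simpa using reduces_zero Z₀ (vertexValue G n) Bf, by simp⟩
    | insert e J he ih =>
      intro hdisj
      rw [Finset.disjoint_insert_left] at hdisj
      obtain ⟨P, H, hP⟩ := ih hdisj.2
      obtain ⟨v, hv, hlink⟩ := hleaf e (hmT e hdisj.1)
      obtain ⟨g, g0, g1, gE⟩ := exists_chain (n := n) hlink.symm s ℓ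
      refine ⟨insert v P, ?_, ?_⟩
      · have h1 := H.leaf (w := v) ((hmB v).2 (Or.inr hv)) g n
          (fun z hz => by rw [g0]; exact hz) g1 (hθ0 e) (hsℓ e) hη0
        simp only [hθ, gE] at h1
        convert h1 using 1
        · funext z
          rw [Finset.sum_insert he, add_comm]
        · rw [Finset.sum_insert he]; ring
        · rw [Finset.card_insert_of_notMem he]; ring
      · intro e' he' v' hv' hl
        rcases Finset.mem_insert.1 he' with rfl | he'
        · rw [hl.left_unique hlink]; exact Finset.mem_insert_self _ _
        · exact Finset.mem_insert_of_mem (hP e' he' v' hv' hl)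
  obtain ⟨P₀, H₀, hP₀⟩ := step1 (Finset.univ \ T) Finset.sdiff_disjoint
  set J := Finset.univ \ T with hJ
  -- eliminate the vertices of the tree
  have step2 : ∀ k ≤ Xf.card, ∃ A ⊆ Xf, A.card = k ∧ (∀ u ∈ X, p u ∈ A → u ∈ A) ∧
      ∃ P : Finset α, P₀ ⊆ P ∧ (∀ v ∈ A, p v ∈ P) ∧
      Reduces Z₀ (vertexValue G n) (Bf \ A) P
        (fun z => ∑ e ∈ J, edgeEnergy n ℓ s e z + ∑ v ∈ A, edgeEnergy n ℓ s (pe v) z)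
        (∑ e ∈ J, (π - (n + 1 : ℕ) * θ e + n * η) +
          ∑ v ∈ A, (-((n + 1 : ℕ) * θ (pe v)) + (n + 1 : ℕ) * η))
        (J.card * n + k * (n + 1)) := by
    intro k
    induction k with
    | zero =>
      intro _
      refine ⟨∅, Finset.empty_subset _, rfl, by simp, P₀, subset_rfl, by simp, ?_⟩
      simpa using H₀
    | succ k ih =>
      intro hk
      obtain ⟨A, hAX, hAk, hAcl, P, hPP, hPA, H⟩ := ih (by omega)
      have hne : (Xf \ A).Nonempty := by
        rw [← Finset.card_pos, Finset.card_sdiff_of_subset hAX]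
        omega
      -- Taking the deepest remaining vertex ensures that its children are already eliminated.
      obtain ⟨v, hv, hmax⟩ := Finset.exists_max_image (Xf \ A) dep hne
      obtain ⟨hvX, hvA⟩ := Finset.mem_sdiff.1 hv
      have hvX' : v ∈ X := (hmX v).1 hvX
      obtain ⟨hlink, hdep⟩ := hp v hvX'
      have hch : ∀ u ∈ X, p u = v → u ∈ A := by
        intro u hu huv
        by_contra huA
        have h1 := hmax u (Finset.mem_sdiff.2 ⟨(hmX u).2 hu, huA⟩)
        have h2 := (hp u hu).2
        rw [huv] at h2
        omega
      -- A vertex without a branch has no phase to propagate. A second edge at `v` excludes this: it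
      -- leads to a child or to `v₀`.
      have hvP : v ∈ P := by
        obtain ⟨e', hne', hinc⟩ := hdeg v (by rw [hV]; exact Or.inr hvX') (pe v).1
        have hvv₀ : v ≠ v₀ := fun h => hv₀ (h ▸ hvX')
        by_cases heT : (⟨e', hinc.edge_mem⟩ : E(G)) ∈ T
        · obtain ⟨u, hu, hue⟩ := Finset.mem_image.1 heT
          have hu' := (hmX u).1 hu
          have h1 := (hp u hu').1
          rw [hue] at h1
          rcases hinc.eq_or_eq_of_isLink h1 with rfl | h2
          · exact absurd (by rw [hue]) hne'
          · rw [h2]; exact hPA u (hch u hu' h2.symm)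
        · obtain ⟨u, hu, h1⟩ := hleaf _ (hmT _ heT)
          rcases hinc.eq_or_eq_of_isLink h1 with rfl | h2
          · exact hPP (hP₀ _ (Finset.mem_sdiff.2 ⟨Finset.mem_univ _, heT⟩) v hvX' h1)
          · exact absurd h2 hvv₀
      have hpv : p v ∈ Bf \ A := by
        refine Finset.mem_sdiff.2 ⟨(hmB _).2 ?_, fun h => hvA (hAcl v hvX' h)⟩
        have := hlink.right_mem
        rwa [hV] at this
      have hpne : p v ≠ v := fun h => by rw [h] at hdep; omega
      obtain ⟨g, g0, g1, gE⟩ := exists_chain (n := n) hlink s ℓ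
      have h1 := H.elim (v := v) (w := p v)
        (Finset.mem_sdiff.2 ⟨(hmB v).2 (Or.inr hvX'), hvA⟩) hvP hpv hpne g (n + 1) g0 g1
        (hθ0 (pe v)) (hsℓ (pe v)) hη0
      simp only [hθ, gE] at h1
      refine ⟨insert v A, Finset.insert_subset hvX hAX, by
        rw [Finset.card_insert_of_notMem hvA, hAk], ?_, insert (p v) P,
        hPP.trans (Finset.subset_insert _ _), ?_, ?_⟩
      · intro u hu hpu
        rcases Finset.mem_insert.1 hpu with h | h
        · exact Finset.mem_insert_of_mem (hch u hu h)
        · exact Finset.mem_insert_of_mem (hAcl u hu h)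
      · intro u hu
        rcases Finset.mem_insert.1 hu with rfl | h
        · exact Finset.mem_insert_self _ _
        · exact Finset.mem_insert_of_mem (hPA u h)
      · convert h1 using 1
        · rw [Finset.sdiff_insert]
        · funext z
          rw [Finset.sum_insert hvA]; ring
        · rw [Finset.sum_insert hvA]; ring
        · ring
  obtain ⟨A, hAX, hAk, -, P, -, hPA, H⟩ := step2 Xf.card le_rfl
  obtain rfl : A = Xf := Finset.eq_of_subset_of_card_le hAX hAk.ge
  obtain ⟨Z, hZ, j, φ, c1, c2, c3, c4, c5⟩ := H
  have hB : Bf \ Xf = {v₀} := by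
    ext v
    rw [Finset.mem_sdiff, hmB, hmX, Finset.mem_singleton]
    constructor
    · rintro ⟨h1 | h1, h2⟩
      · exact h1
      · exact absurd h1 h2
    · rintro rfl
      exact ⟨Or.inl rfl, hv₀⟩
  rw [hB, Finset.sum_singleton] at c3
  have hφ : 0 < φ v₀ := c2 v₀ (hpr ▸ hPA r ((hmX r).2 hr))
  have hinj' : Set.InjOn pe (Xf : Set α) := fun x hx y hy h =>
    hinj ((hmX x).1 hx) ((hmX y).1 hy) h
  have hsumT : ∀ q : E(G) → ℝ, ∑ v ∈ Xf, q (pe v) = ∑ e ∈ T, q e := fun q => by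
    rw [hT, Finset.sum_image hinj']
  have hsumE : ∀ q : E(G) → ℝ, ∑ e ∈ J, q e + ∑ e ∈ T, q e = ∑ e, q e := fun q =>
    Finset.sum_sdiff (Finset.subset_univ T)
  have hcardT : T.card = Xf.card := Finset.card_image_of_injOn hinj'
  have hcardJ : J.card + T.card = m := by
    rw [hJ, Finset.card_sdiff_of_subset (Finset.subset_univ T), Finset.card_univ]
    have := Finset.card_le_univ T
    omega
  have hcardB : Bf.card = Xf.card + 1 := by
    have : Bf = insert v₀ Xf := by
      ext v; rw [hmB, Finset.mem_insert, hmX]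
    rw [this, Finset.card_insert_of_notMem (by rwa [hmX])]
  have hVcard : V(G).ncard = Xf.card + 1 := by
    rw [← hcardB, hBf, Set.ncard_eq_toFinset_card _ hVfin]
  have hEcard : E(G).ncard = m := by
    rw [hm, ← Nat.card_eq_fintype_card]; rfl
  have hbetti : (bettiNumber G : ℝ) = J.card := by
    rw [bettiNumber, hVcard, hEcard, ← hcardJ, hcardT]
    push_cast
    ring
  have hj : 2 ≤ j := by
    have e1 : ∑ e ∈ J, (π - (n + 1 : ℕ) * θ e + n * η) ≤
        ∑ e ∈ J, (-((n + 1 : ℕ) * θ e) + (n + 1 : ℕ) * η) + J.card * π := by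
      rw [← nsmul_eq_mul J.card, ← Finset.sum_const, ← Finset.sum_add_distrib]
      refine Finset.sum_le_sum fun e _ => ?_
      push_cast
      linarith
    rw [hsumT fun e => (-((n + 1 : ℕ) * θ e) + (n + 1 : ℕ) * η)] at c3
    have e2 := hsumE fun e => (-((n + 1 : ℕ) * θ e) + (n + 1 : ℕ) * η)
    have e3 : ∑ e, (-((n + 1 : ℕ) * θ e) + (n + 1 : ℕ) * η) =
        -(s * length G ℓ) + m * ((n + 1) * η) := by
      rw [Finset.sum_add_distrib, Finset.sum_const, Finset.card_univ, ← hm, length, Finset.mul_sum,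
        ← Finset.sum_neg_distrib, nsmul_eq_mul]
      push_cast
      congr 1
      refine Finset.sum_congr rfl fun e _ => ?_
      simp only [hθ]
      field_simp
    have e4 : m * ((n + 1) * η) < δ := by
      have : η * (m * (n + 1) + 1) = δ := by rw [hη]; field_simp
      nlinarith
    rw [hbetti] at hδ
    have e5 : 0 < (j - 1 : ℝ) * π := by linarith
    have e6 : 0 < (j - 1 : ℝ) := pos_of_mul_pos_left e5 pi_pos.le
    have e7 : (1 : ℝ) < j := by linarith
    exact_mod_cast e7
  refine ⟨Z, ?_, fun z hz => hZ hz, fun z hz => ?_⟩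
  -- The number of eliminated variables is exactly the number of nodes other than `v₀`, so `j`
  -- dimensions survive.
  · have h1 := finrank_le_inf_ker (⊤ : Submodule ℝ (Node G n → ℝ)) (vertexValue G n v₀)
    rw [top_inf_eq, finrank_top, Module.finrank_fintype_fun_eq_card] at h1
    have h2 : Fintype.card (Node G n) = (Xf.card + 1) + m * n := by
      rw [Fintype.card_sum, Fintype.card_prod, Fintype.card_fin, ← hVcard]
      congr 1
      rw [← Nat.card_eq_fintype_card]; rfl
    rw [h2, ← hZ₀] at h1
    rw [← hcardT] at h1 c4
    have h3 : m * n = J.card * n + T.card * n := by rw [← hcardJ]; ring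
    have h4 : T.card * (n + 1) = T.card * n + T.card := by ring
    omega
  · rw [subdivForm_self hs hℓ hsℓ]
    refine mul_nonpos_of_nonneg_of_nonpos hs.le ?_
    have h1 := c5 z hz
    beta_reduce at h1
    rw [hB, Finset.sum_singleton, hsumT fun e => edgeEnergy n ℓ s e z, hsumE] at h1
    have h2 : vertexValue G n v₀ z = 0 := hZ hz
    rw [h2] at h1
    simpa using h1

end

/-! ### Consequences of connectedness, and the bound for the first eigenvalue. -/

section

universe u v
variable {α : Type u} {β : Type v} {G : Graph α β}

theorem exists_inc (hconn : Connected G) (hedge : E(G).Nonempty) {x : α} (hx : x ∈ V(G)) :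
    ∃ e, G.Inc e x := by
  obtain ⟨e, he⟩ := hedge
  obtain ⟨y, z, hyz⟩ := G.exists_isLink_of_mem_edgeSet he
  rcases Relation.ReflTransGen.cases_head (hconn.2 x hx y hyz.left_mem) with rfl | ⟨w, ⟨e', he'⟩, _⟩
  · exact ⟨e, hyz.inc_left⟩
  · exact ⟨e', he'.inc_left⟩

theorem exists_inc_ne (hconn : Connected G) (hedge : E(G).Nonempty)
    (hloop : ∀ e x, ¬ G.IsLoopAt e x) (hpend : ∀ x, ¬ IsPendant G x) {x : α} (hx : x ∈ V(G))
    (e : β) : ∃ e', e' ≠ e ∧ G.Inc e' x := by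
  by_contra! hcon
  obtain ⟨e₁, he₁⟩ := exists_inc hconn hedge hx
  apply hpend x
  refine ⟨hx, ?_⟩
  have h1 : G.incidenceSet x = {e₁} := by
    ext e'
    constructor
    · intro h'
      have h2 : e' = e := by_contra fun h3 => hcon e' h3 h'
      have h3 : e₁ = e := by_contra fun h4 => hcon e₁ h4 he₁
      rw [h2, h3]; rfl
    · rintro rfl
      exact he₁
  have h2 : G.loopSet x = ∅ := Set.eq_empty_of_forall_notMem fun e' h' => hloop e' x h'
  rw [degree, h1, h2]
  simp

theorem exists_tail_or_head (hconn : Connected G) (hedge : E(G).Nonempty) {x : α}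
    (hx : x ∈ V(G)) : ∃ e, tail G e = x ∨ head G e = x := by
  obtain ⟨e, he⟩ := exists_inc hconn hedge hx
  refine ⟨⟨e, he.edge_mem⟩, ?_⟩
  rcases he.eq_or_eq_of_isLink (isLink_tail_head G ⟨e, he.edge_mem⟩) with h | h
  · exact Or.inl h.symm
  · exact Or.inr h.symm

theorem length_pos [Fintype E(G)] (hedge : E(G).Nonempty) {ℓ : E(G) → ℝ} (hℓ : IsMetric G ℓ) :
    0 < length G ℓ := by
  have : Nonempty E(G) := hedge.to_subtype
  exact Finset.sum_pos (fun e _ => hℓ e) Finset.univ_nonempty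

theorem exists_isNthEigenvalue_one_le [Finite V(G)] [Fintype E(G)]
    (hconn : Connected G) (hedge : E(G).Nonempty) (hloop : ∀ e x, ¬ G.IsLoopAt e x)
    (hpend : ∀ x, ¬ IsPendant G x) {X : Set α} {v₀ : α} (hv₀ : v₀ ∉ X)
    (hV : V(G) = insert v₀ X) (hX : IsTree (G.induce X)) {ℓ : E(G) → ℝ} (hℓ : IsMetric G ℓ) :
    ∃ μ, IsNthEigenvalue G ℓ 1 μ ∧
      μ ≤ (1 + (bettiNumber G : ℝ)) ^ 2 * π ^ 2 / length G ℓ ^ 2 := by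
  obtain ⟨p, pe, dep, r, hr, hpr, -, hp, hinj, hleaf⟩ := exists_parent hloop hconn hv₀ hV hX
  have hL := length_pos hedge hℓ
  have hne : Nonempty E(G) := hedge.to_subtype
  have hv₀V : v₀ ∈ V(G) := by rw [hV]; exact Set.mem_insert _ _
  set S₀ := (1 + (bettiNumber G : ℝ)) * π / length G ℓ with hS₀
  -- This avoids proving that the Betti number is nonnegative; positivity of `s` discards the second
  -- case at the end.
  set S₁ := max S₀ 0 with hS₁
  have hS₁0 : 0 ≤ S₁ := le_max_right _ _
  obtain ⟨n, hn⟩ := exists_nat_gt ((S₁ + 1) * length G ℓ)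
  have hshort : ∀ s, s ≤ S₁ + 1 → ∀ e, s * (ℓ e / (n + 1)) < π := by
    intro s hs e
    have h1 : ℓ e ≤ length G ℓ := Finset.single_le_sum (f := ℓ) (fun e _ => (hℓ e).le)
      (Finset.mem_univ e)
    have h2 : s * ℓ e ≤ (S₁ + 1) * length G ℓ :=
      mul_le_mul hs h1 (hℓ e).le (by linarith)
    rw [← mul_div_assoc, div_lt_iff₀ (by positivity)]
    have h3 : (1 : ℝ) * (n + 1) ≤ π * (n + 1) := by
      have := pi_gt_three
      gcongr
      linarith
    linarith
  have hcon : ∀ x : Node G n → ℝ, (∀ f : E(G) × Fin (n + 1), x (node n f.1 f.2) =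
      x (node n f.1 (f.2 + 1))) → x (Sum.inl ⟨v₀, hv₀V⟩) = 0 → x = 0 := by
    classical
    intro x hx hx0
    have h1 : ∀ e k, k ≤ n + 1 → x (node n e k) = x (node n e 0) := by
      intro e k
      induction k with
      | zero => intro _; rfl
      | succ k ih =>
        intro hk
        rw [← ih (by omega)]
        exact (hx (e, ⟨k, by omega⟩)).symm
    let val : α → ℝ := fun v => if h : v ∈ V(G) then x (Sum.inl ⟨v, h⟩) else 0
    have h2 : ∀ e, val (head G e) = val (tail G e) := by
      intro e
      have := h1 e (n + 1) le_rfl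
      rw [node_zero, node_last] at this
      simpa [val, (isLink_tail_head G e).left_mem, (isLink_tail_head G e).right_mem] using this
    have h3 : ∀ v (hv : v ∈ V(G)), x (Sum.inl ⟨v, hv⟩) = 0 := by
      intro v hv
      have := val_eq_of_connected hconn h2 hv hv₀V
      simpa [val, hv, hv₀V, hx0] using this
    funext i
    rcases i with ⟨v, hv⟩ | ⟨e, i⟩
    · exact h3 v hv
    · rw [← node_succ, h1 e _ (by omega), node_zero]
      exact h3 _ _
  have key : ∀ ε, 0 < ε → ε ≤ 1 → ∃ s, 0 < s ∧ s ≤ S₁ + ε ∧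
      (∃ x : Node G n → ℝ, x ≠ 0 ∧ ∀ y, subdivForm n ℓ s x y = 0) ∧
      ∀ s', 0 < s' → s' < s → ∀ x : Node G n → ℝ, (∀ y, subdivForm n ℓ s' x y = 0) → x = 0 := by
    intro ε hε hε1
    have hpos : 0 < S₁ + ε := by linarith
    obtain ⟨Z, hZ, hZ0, hZS⟩ := exists_submodule_of_parent (n := n) (s := S₁ + ε) (ℓ := ℓ)
      (fun v hv e => exists_inc_ne hconn hedge hloop hpend hv e) hv₀ hV hr hpr hp hinj hleaf hpos hℓ
      (hshort _ (by linarith)) (by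
        rw [← div_lt_iff₀ hL]
        have := le_max_left S₀ 0
        linarith)
    refine exists_min_frequency (S := S₁ + ε) (fun f => ?_) (fun f => hshort _ (by linarith) f.1)
      hpos.le (Sum.inl ⟨v₀, hv₀V⟩) hcon Z hZ (fun z hz => ?_) hZS
    · have := hℓ f.1
      positivity
    · have := hZ0 z hz
      rwa [vertexValue, dif_pos hv₀V] at this
  obtain ⟨s, hs0, hsS, ⟨x, hx0, hx⟩, hmin⟩ := key 1 one_pos le_rfl
  -- The elimination needs a strict inequality, hence the `ε`. The subdivision does not depend on
  -- `ε`, so the minimal frequency is the same for all `ε`.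
  have hsS₁ : s ≤ S₁ := by
    refine le_of_forall_pos_le_add fun ε hε => ?_
    rcases le_or_gt ε 1 with h1 | h1
    · obtain ⟨s', hs'0, hs'S, ⟨x', hx'0, hx'⟩, -⟩ := key ε hε h1
      refine le_trans ?_ hs'S
      by_contra! hlt
      exact hx'0 (hmin s' hs'0 hlt x' hx')
    · linarith
  have hsS₀ : s ≤ S₀ := by
    rcases le_max_iff.1 hsS₁ with h | h
    · exact h
    · linarith
  obtain ⟨f, hf0, hf⟩ := exists_solves_of_ker hs0 hℓ (hshort s hsS)
    (fun v hv => exists_tail_or_head hconn hedge hv) hx0 hx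
  refine ⟨s ^ 2, isNthEigenvalue_one hconn hedge hℓ hs0 hf0 hf ?_, ?_⟩
  · intro s' hs'0 hs's g hg
    obtain ⟨y, hy, hyg⟩ := exists_ker_of_solves hs'0 hℓ (hshort s' (by linarith)) hg
    exact hyg (hmin s' hs'0 hs's y hy)
  · calc s ^ 2 ≤ S₀ ^ 2 := by gcongr
      _ = _ := by rw [hS₀, div_pow, mul_pow]

end

section

/-! ### The lower bound -/

theorem mul_sinc (x : ℝ) : x * sinc x = sin x := by
  rcases eq_or_ne x 0 with rfl | hx
  · simp
  · rw [sinc_of_ne_zero hx]; field_simp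

theorem sinc_eq_half (x : ℝ) : sinc x = sinc (x / 2) * cos (x / 2) := by
  rcases eq_or_ne x 0 with rfl | hx
  · simp
  · rw [sinc_of_ne_zero hx, sinc_of_ne_zero (by simpa using hx : x / 2 ≠ 0)]
    conv_lhs => rw [show x = 2 * (x / 2) by ring, sin_two_mul]
    field_simp

/-- After clearing denominators this is `sin (s / 2) ^ 2 < 1`: the antisymmetric mode on unit edges
joining two vertices has no frequency below `π`. -/
theorem sq_mul_massWeight_lt {s : ℝ} (h0 : 0 ≤ s) (h1 : s < π) :
    s ^ 2 * massWeight s 1 < 2 / sinc s := by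
  have hc : 0 < cos (s / 2) := cos_pos_of_mem_Ioo ⟨by linarith, by linarith⟩
  have hs : 0 < sinc (s / 2) := sinc_pos (by linarith) (by linarith)
  rw [sinc_eq_half, massWeight, mul_one]
  have h2 : (s / 2 * sinc (s / 2)) ^ 2 < 1 := by
    rw [mul_sinc]
    nlinarith [sin_sq_add_cos_sq (s / 2), sq_pos_of_pos hc]
  rw [lt_div_iff₀ (by positivity)]
  calc s ^ 2 * (1 / 2 * sinc (s / 2) / cos (s / 2)) * (sinc (s / 2) * cos (s / 2))
      = 2 * (s / 2 * sinc (s / 2)) ^ 2 := by field_simp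
    _ < 2 := by linarith

theorem form_smul_left {I F : Type*} [Fintype F] {a b : F → I} {h : F → ℝ} (s t : ℝ) (x y : I → ℝ) :
    form a b h s (t • x) y = t * form a b h s x y := by
  have := form_add_smul_left (a := a) (b := b) (h := h) s t 0 x y
  have h0 : form a b h s 0 y = 0 := by simp [form]
  rwa [zero_add, h0, zero_add] at this

section Collapse

variable {I F : Type*} [Fintype I] [DecidableEq I] [Fintype F] [DecidableEq F]
  (a b : F → I) (D : Finset F)

/-- The lengths which are `1` on the edges in `D` and `ε` on the other edges. -/
def collapsedLength (ε : ℝ) (f : F) : ℝ := if f ∈ D then 1 else ε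

variable {a b D}

/-- The form itself blows up as `ε → 0`. Three consequences of the kernel equation stay continuous
there and already exclude nonzero solutions in the limit; compactness then excludes small `ε`. -/
theorem exists_collapse {s₁ : ℝ} (hs₁0 : 0 ≤ s₁) (hs₁ : s₁ < π) (hD : D.Nonempty) (i₀ : I)
    (hDi : ∀ f ∈ D, (a f = i₀ ∧ b f ≠ i₀) ∨ (a f ≠ i₀ ∧ b f = i₀))
    (hDc : ∀ f ∉ D, a f ≠ i₀ ∧ b f ≠ i₀)
    (hconn : ∀ x : I → ℝ, (∀ f ∉ D, x (a f) = x (b f)) → ∀ i j, i ≠ i₀ → j ≠ i₀ → x i = x j) :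
    ∃ ε, 0 < ε ∧ ε ≤ 1 ∧ ∀ s, 0 < s → s ≤ s₁ → ∀ x : I → ℝ,
      (∀ y, form a b (collapsedLength D ε) s x y = 0) → x = 0 := by
  -- These come from testing against the delta at `i₀`, against constants (divided by `-s ^ 2`), and
  -- against `x` itself (multiplied by `ε`).
  let E1 : ℝ → ℝ → (I → ℝ) → ℝ := fun _ s x => ∑ f ∈ D,
    ((2 * x i₀ - (x (a f) + x (b f))) / sinc s - s ^ 2 * massWeight s 1 * x i₀)
  let E2 : ℝ → ℝ → (I → ℝ) → ℝ := fun ε s x => ∑ f ∈ D, massWeight s 1 * (x (a f) + x (b f)) +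
    ∑ f ∈ Dᶜ, massWeight s ε * (x (a f) + x (b f))
  let E3 : ℝ → ℝ → (I → ℝ) → ℝ := fun ε s x => ε * ∑ f ∈ D, ((x (a f) - x (b f)) ^ 2 / sinc s -
      s ^ 2 * massWeight s 1 * (x (a f) ^ 2 + x (b f) ^ 2)) +
    ∑ f ∈ Dᶜ, ((x (a f) - x (b f)) ^ 2 / sinc (s * ε) -
      ε * (s ^ 2 * massWeight s ε * (x (a f) ^ 2 + x (b f) ^ 2)))
  have hE : ∀ ε s x, 0 < ε → 0 < s → (∀ y, form a b (collapsedLength D ε) s x y = 0) →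
      E1 ε s x = 0 ∧ E2 ε s x = 0 ∧ E3 ε s x = 0 := by
    intro ε s x hε hs hx
    have hsplit : ∀ y, form a b (collapsedLength D ε) s x y =
        ∑ f ∈ D, ((x (a f) - x (b f)) * (y (a f) - y (b f)) / sinc s -
          s ^ 2 * massWeight s 1 * (x (a f) * y (a f) + x (b f) * y (b f))) +
        ∑ f ∈ Dᶜ, ((x (a f) - x (b f)) * (y (a f) - y (b f)) / (ε * sinc (s * ε)) -
          s ^ 2 * massWeight s ε * (x (a f) * y (a f) + x (b f) * y (b f))) := by
      intro y
      rw [form, ← Finset.sum_add_sum_compl D]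
      congr 1
      · refine Finset.sum_congr rfl fun f hf => ?_
        rw [collapsedLength, if_pos hf, mul_one, one_mul]
      · refine Finset.sum_congr rfl fun f hf => ?_
        rw [collapsedLength, if_neg (Finset.mem_compl.1 hf)]
    refine ⟨?_, ?_, ?_⟩
    · have h1 := hx (Pi.single i₀ 1)
      rw [hsplit, Finset.sum_eq_zero (s := Dᶜ), add_zero] at h1
      · rw [← h1]
        refine Finset.sum_congr rfl fun f hf => ?_
        rcases hDi f hf with ⟨h2, h3⟩ | ⟨h2, h3⟩
        · rw [h2, Pi.single_eq_same, Pi.single_eq_of_ne h3]; ring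
        · rw [h3, Pi.single_eq_same, Pi.single_eq_of_ne h2]; ring
      · intro f hf
        obtain ⟨h2, h3⟩ := hDc f (Finset.mem_compl.1 hf)
        rw [Pi.single_eq_of_ne h2, Pi.single_eq_of_ne h3]
        simp
    · have h1 := hx fun _ => 1
      have h2 : -(s ^ 2 * E2 ε s x) = 0 := by
        rw [← h1, hsplit]
        simp only [E2, mul_add, Finset.mul_sum, neg_add, ← Finset.sum_neg_distrib]
        congr 1 <;> exact Finset.sum_congr rfl fun f _ => by ring
      have h3 : s ^ 2 ≠ 0 := by positivity
      simpa [h3, hs.ne'] using h2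
    · have h1 := hx x
      rw [← mul_zero ε, ← h1, hsplit, mul_add, Finset.mul_sum (s := Dᶜ)]
      simp only [E3]
      congr 1
      · congr 1
        exact Finset.sum_congr rfl fun f _ => by ring
      · refine Finset.sum_congr rfl fun f _ => ?_
        rw [mul_sub, ← mul_div_assoc, mul_div_mul_left _ _ hε.ne']
        ring
  -- the limiting problem has no solutions
  have hE0 : ∀ s x, 0 ≤ s → s ≤ s₁ → E1 0 s x = 0 → E2 0 s x = 0 → E3 0 s x = 0 → x = 0 := by
    intro s x hs hss h1 h2 h3
    have hm0 : massWeight s 0 = 0 := by simp [massWeight]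
    simp only [E1, E2, E3, hm0, zero_mul, Finset.sum_const_zero, add_zero, mul_zero, sinc_zero,
      div_one, sub_zero, zero_add] at h1 h2 h3
    have h4 : ∀ f ∉ D, x (a f) = x (b f) := by
      intro f hf
      have := (Finset.sum_eq_zero_iff_of_nonneg fun f _ => sq_nonneg _).1 h3 f
        (Finset.mem_compl.2 hf)
      rw [sq_eq_zero_iff] at this
      linarith
    have h5 := hconn x h4
    obtain ⟨f₀, hf₀⟩ := hD
    obtain ⟨i₁, hi₁⟩ : ∃ i, i ≠ i₀ := by
      rcases hDi f₀ hf₀ with ⟨_, h⟩ | ⟨h, _⟩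
      · exact ⟨_, h⟩
      · exact ⟨_, h⟩
    have h6 : ∀ f ∈ D, x (a f) + x (b f) = x i₀ + x i₁ := by
      intro f hf
      rcases hDi f hf with ⟨h, h'⟩ | ⟨h, h'⟩
      · rw [h, h5 _ i₁ h' hi₁]
      · rw [h', h5 _ i₁ h hi₁, add_comm]
    have hcard : (D.card : ℝ) ≠ 0 := by
      have := Finset.card_pos.2 ⟨f₀, hf₀⟩
      positivity
    have hm1 : massWeight s 1 ≠ 0 := (massWeight_pos one_pos hs (by linarith)).ne'
    rw [Finset.sum_congr rfl fun f hf => by rw [h6 f hf], Finset.sum_const, nsmul_eq_mul] at h1 h2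
    have h7 : x i₀ + x i₁ = 0 := by simpa [hcard, hm1] using h2
    rw [h7] at h1
    have h8 : x i₀ * (2 / sinc s - s ^ 2 * massWeight s 1) = 0 := by
      have := (mul_eq_zero.1 h1).resolve_left hcard
      rw [← this]
      ring
    have h9 : x i₀ = 0 := (mul_eq_zero.1 h8).resolve_right
      (sub_pos.2 (sq_mul_massWeight_lt hs (by linarith))).ne'
    funext i
    rcases eq_or_ne i i₀ with rfl | hi
    · exact h9
    · rw [h5 i i₁ hi hi₁]
      simpa [h9] using h7
  -- compactness
  let U : Set (ℝ × ℝ × (I → ℝ)) := Set.Icc 0 1 ×ˢ (Set.Icc 0 s₁ ×ˢ Metric.sphere 0 1)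
  have hU : IsCompact U := isCompact_Icc.prod (isCompact_Icc.prod (isCompact_sphere _ _))
  have hx : ∀ i, ContinuousOn (fun q : ℝ × ℝ × (I → ℝ) => q.2.2 i) U := fun i => by fun_prop
  have hs : ContinuousOn (fun q : ℝ × ℝ × (I → ℝ) => q.2.1) U := by fun_prop
  have hε : ContinuousOn (fun q : ℝ × ℝ × (I → ℝ) => q.1) U := by fun_prop
  have hsε : ∀ q ∈ U, 0 ≤ q.2.1 * q.1 ∧ q.2.1 * q.1 < π := by
    rintro ⟨ε, s, x⟩ ⟨⟨h1, h2⟩, ⟨h3, h4⟩, -⟩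
    simp only at h1 h2 h3 h4 ⊢
    exact ⟨by positivity, by nlinarith⟩
  have hm1 : ContinuousOn (fun q : ℝ × ℝ × (I → ℝ) => massWeight q.2.1 1) U :=
    (continuousOn_massWeight one_pos (by linarith : s₁ * 1 < π)).comp hs fun q hq => hq.2.1
  have hmε : ContinuousOn (fun q : ℝ × ℝ × (I → ℝ) => massWeight q.2.1 q.1) U := by
    unfold massWeight
    refine ContinuousOn.div ((hε.div_const 2).mul ?_) ?_ ?_
    · exact continuous_sinc.comp_continuousOn ((hs.mul hε).div_const 2)
    · exact continuous_cos.comp_continuousOn ((hs.mul hε).div_const 2)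
    · intro q hq
      have := hsε q hq
      exact (cos_pos_of_mem_Ioo ⟨by linarith, by linarith⟩).ne'
  have hc1 : ContinuousOn (fun q : ℝ × ℝ × (I → ℝ) => sinc q.2.1) U :=
    continuous_sinc.comp_continuousOn hs
  have hcε : ContinuousOn (fun q : ℝ × ℝ × (I → ℝ) => sinc (q.2.1 * q.1)) U :=
    continuous_sinc.comp_continuousOn (hs.mul hε)
  have hn1 : ∀ q ∈ U, sinc q.2.1 ≠ 0 := fun q hq =>
    (sinc_pos hq.2.1.1 (hq.2.1.2.trans_lt hs₁)).ne'
  have hnε : ∀ q ∈ U, sinc (q.2.1 * q.1) ≠ 0 := fun q hq =>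
    (sinc_pos (hsε q hq).1 (hsε q hq).2).ne'
  have hC1 : ContinuousOn (fun q : ℝ × ℝ × (I → ℝ) => E1 q.1 q.2.1 q.2.2) U :=
    continuousOn_finsetSum _ fun f _ =>
      (((continuousOn_const.mul (hx _)).sub ((hx _).add (hx _))).div hc1 hn1).sub
        (((hs.pow 2).mul hm1).mul (hx _))
  have hC2 : ContinuousOn (fun q : ℝ × ℝ × (I → ℝ) => E2 q.1 q.2.1 q.2.2) U :=
    (continuousOn_finsetSum _ fun f _ => hm1.mul ((hx _).add (hx _))).add
      (continuousOn_finsetSum _ fun f _ => hmε.mul ((hx _).add (hx _)))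
  have hC3 : ContinuousOn (fun q : ℝ × ℝ × (I → ℝ) => E3 q.1 q.2.1 q.2.2) U :=
    (hε.mul (continuousOn_finsetSum _ fun f _ => ((((hx _).sub (hx _)).pow 2).div hc1 hn1).sub
      (((hs.pow 2).mul hm1).mul (((hx _).pow 2).add ((hx _).pow 2))))).add
    (continuousOn_finsetSum _ fun f _ => ((((hx _).sub (hx _)).pow 2).div hcε hnε).sub
      (hε.mul (((hs.pow 2).mul hmε).mul (((hx _).pow 2).add ((hx _).pow 2)))))
  let K : Set (ℝ × ℝ × (I → ℝ)) := U ∩ (fun q : ℝ × ℝ × (I → ℝ) =>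
    (E1 q.1 q.2.1 q.2.2, E2 q.1 q.2.1 q.2.2, E3 q.1 q.2.1 q.2.2)) ⁻¹' {0}
  have hK : IsCompact K := by
    refine hU.of_isClosed_subset ?_ Set.inter_subset_left
    exact (hC1.prodMk (hC2.prodMk hC3)).preimage_isClosed_of_isClosed hU.isClosed
      isClosed_singleton
  have hmem : ∀ ε s x, 0 < ε → ε ≤ 1 → 0 < s → s ≤ s₁ → x ≠ 0 →
      (∀ y, form a b (collapsedLength D ε) s x y = 0) → (ε, s, ‖x‖⁻¹ • x) ∈ K := by
    intro ε s x h1 h2 h3 h4 hx0 hxk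
    obtain ⟨e1, e2, e3⟩ := hE ε s (‖x‖⁻¹ • x) h1 h3 fun y => by
      rw [form_smul_left, hxk, mul_zero]
    refine ⟨⟨⟨h1.le, h2⟩, ⟨h3.le, h4⟩, by simp [norm_smul, norm_ne_zero_iff.2 hx0]⟩, ?_⟩
    simp only [Set.mem_preimage, e1, e2, e3]
    rfl
  rcases K.eq_empty_or_nonempty with hKe | hKn
  · refine ⟨1, one_pos, le_rfl, fun s h3 h4 x hxk => ?_⟩
    by_contra hx0
    have := hmem 1 s x one_pos le_rfl h3 h4 hx0 hxk
    rw [hKe] at this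
    exact this
  · obtain ⟨⟨ε₀, s₀, x₀⟩, ⟨⟨h1, h2, h3⟩, h4⟩, hmin⟩ :=
      hK.exists_isMinOn hKn continuous_fst.continuousOn
    have hε₀ : 0 < ε₀ := by
      refine lt_of_le_of_ne h1.1 ?_
      rintro rfl
      have h5 := Prod.ext_iff.1 (Set.mem_singleton_iff.1 h4)
      have h6 := Prod.ext_iff.1 h5.2
      have h7 : x₀ = 0 := hE0 s₀ x₀ h2.1 h2.2 h5.1 h6.1 h6.2
      rw [h7] at h3
      simp at h3
    have hε₁ : ε₀ ≤ 1 := h1.2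
    -- `ε₀` is the least length for which the three equations are solvable, so anything positive
    -- below it works.
    refine ⟨ε₀ / 2, by linarith, by linarith, fun s h5 h6 x hxk => ?_⟩
    by_contra hx0
    have : ε₀ ≤ ε₀ / 2 := hmin (hmem (ε₀ / 2) s x (by linarith) (by linarith) h5 h6 hx0 hxk)
    linarith

end Collapse

universe u v
variable {α : Type u} {β : Type v} {G : Graph α β}

theorem exists_vertex_ker_of_solves [Finite V(G)] [Fintype E(G)] {ℓ : E(G) → ℝ} {s : ℝ}
    (hs : 0 < s) (hℓ : ∀ e, 0 < ℓ e) (hsℓ : ∀ e, s * ℓ e < π) {f : E(G) → ℝ → ℝ}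
    (hf : SolvesNeumannProblem G ℓ (s ^ 2) f) :
    ∃ x : V(G) → ℝ, (∀ y, form (fun e : E(G) => (⟨tail G e, (isLink_tail_head G e).left_mem⟩ : V(G)))
      (fun e => ⟨head G e, (isLink_tail_head G e).right_mem⟩) ℓ s x y = 0) ∧ (x = 0 → f = 0) := by
  obtain ⟨x, hx, hxf⟩ := exists_ker_of_solves (n := 0) hs hℓ (by simpa using hsℓ) hf
  refine ⟨fun v => x (Sum.inl v), fun y => ?_, fun h => hxf ?_⟩
  · rw [← hx (Sum.elim y 0), subdivForm, form, form, Fintype.sum_prod_type]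
    refine Finset.sum_congr rfl fun e _ => ?_
    simp [node]
  · funext i
    rcases i with v | ⟨_, i⟩
    · exact congrFun h v
    · exact i.elim0

theorem le_of_forall_exists_isNthEigenvalue [Finite V(G)] [Fintype E(G)]
    (hconn : Connected G) (hloop : ∀ e x, ¬ G.IsLoopAt e x) {X : Set α} {v₀ : α} (hv₀ : v₀ ∉ X)
    (hV : V(G) = insert v₀ X) (hX : IsTree (G.induce X)) {c : ℝ}
    (hc : ∀ ℓ : E(G) → ℝ, IsMetric G ℓ → ∃ μ, IsNthEigenvalue G ℓ 1 μ ∧ μ ≤ c / length G ℓ ^ 2) :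
    (1 + (bettiNumber G : ℝ)) ^ 2 * π ^ 2 ≤ c := by
  classical
  have := Fintype.ofFinite V(G)
  obtain ⟨p, pe, dep, r, hr, hpr, hpX, hp, hinj, hleaf⟩ := exists_parent hloop hconn hv₀ hV hX
  have hXfin : X.Finite := (Set.toFinite V(G)).subset (by rw [hV]; exact Set.subset_insert _ _)
  have hv₀V : v₀ ∈ V(G) := by rw [hV]; exact Set.mem_insert _ _
  set Xf := hXfin.toFinset with hXf
  have hmX : ∀ v, v ∈ Xf ↔ v ∈ X := fun v => hXfin.mem_toFinset
  -- Erasing `r` leaves the edges of the induced tree; the parent edge of `r` ends at `v₀` and joins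
  -- the long edges in `D`.
  set T : Finset E(G) := (Xf.erase r).image pe with hT
  set D : Finset E(G) := Tᶜ with hDdef
  have hmT : ∀ e, e ∈ T ↔ ∃ v ∈ X, v ≠ r ∧ pe v = e := by
    intro e
    rw [hT, Finset.mem_image]
    simp only [Finset.mem_erase, hmX]
    constructor
    · rintro ⟨v, ⟨h1, h2⟩, h3⟩; exact ⟨v, h2, h1, h3⟩
    · rintro ⟨v, h1, h2, h3⟩; exact ⟨v, ⟨h2, h1⟩, h3⟩
  have hD : ∀ e ∈ D, ∃ v ∈ X, G.IsLink e.1 v v₀ := by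
    intro e he
    have heT : e ∉ T := Finset.mem_compl.1 he
    by_cases h : e ∈ pe '' X
    · obtain ⟨v, hv, rfl⟩ := h
      have hvr : v = r := by_contra fun h' => heT ((hmT _).2 ⟨v, hv, h', rfl⟩)
      subst hvr
      refine ⟨v, hv, ?_⟩
      rw [← hpr]
      exact (hp v hv).1
    · exact hleaf e h
  have hDc : ∀ e ∉ D, ∃ v ∈ X, v ≠ r ∧ pe v = e := fun e he => by
    rw [← hmT]
    simpa [hDdef] using he
  have hinj' : Set.InjOn pe (Xf.erase r : Finset α) := by
    intro x hx y hy h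
    rw [Finset.mem_coe, Finset.mem_erase, hmX] at hx hy
    exact hinj hx.2 hy.2 h
  have hcardD : (D.card : ℝ) = 1 + (bettiNumber G : ℝ) := by
    have h1 : T.card = Xf.card - 1 := by
      rw [hT, Finset.card_image_of_injOn hinj', Finset.card_erase_of_mem ((hmX r).2 hr)]
    have h2 : D.card + T.card = E(G).ncard := by
      rw [hDdef, add_comm, Finset.card_add_card_compl, ← Nat.card_eq_fintype_card]
      rfl
    have h3 : V(G).ncard = Xf.card + 1 := by
      rw [hV, Set.ncard_insert_of_notMem hv₀ hXfin, Set.ncard_eq_toFinset_card _ hXfin]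
    have h4 : 0 < Xf.card := Finset.card_pos.2 ⟨r, (hmX r).2 hr⟩
    have h5 : (D.card : ℤ) = 1 + bettiNumber G := by
      rw [bettiNumber]
      omega
    exact_mod_cast h5
  have hDne : D.Nonempty := by
    refine ⟨pe r, Finset.mem_compl.2 fun h => ?_⟩
    obtain ⟨v, hv, hvr, h⟩ := (hmT _).1 h
    exact hvr (hinj hv hr h)
  rw [← hcardD]
  have hd : (0 : ℝ) < D.card := by exact_mod_cast Finset.card_pos.2 hDne
  have hmem : ∀ v : V(G), v ≠ ⟨v₀, hv₀V⟩ → (v : α) ∈ X := by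
    rintro ⟨v, hv⟩ hne
    rw [hV] at hv
    exact hv.resolve_left fun h => hne (Subtype.ext h)
  have key : ∀ s₁, 0 ≤ s₁ → s₁ < π → s₁ ^ 2 * (D.card : ℝ) ^ 2 ≤ c := by
    intro s₁ hs₁0 hs₁
    obtain ⟨ε, hε0, hε1, hε⟩ : ∃ ε, 0 < ε ∧ ε ≤ 1 ∧ ∀ s, 0 < s → s ≤ s₁ → ∀ x : V(G) → ℝ,
        (∀ y, form (fun e : E(G) => (⟨tail G e, (isLink_tail_head G e).left_mem⟩ : V(G)))
          (fun e => ⟨head G e, (isLink_tail_head G e).right_mem⟩)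
          (collapsedLength D ε) s x y = 0) → x = 0 := by
      refine exists_collapse hs₁0 hs₁ hDne ⟨v₀, hv₀V⟩ ?_ ?_ ?_
      · intro e he
        obtain ⟨v, hv, hlink⟩ := hD e he
        have hvv : v ≠ v₀ := fun h => hv₀ (h ▸ hv)
        rcases (isLink_tail_head G e).eq_and_eq_or_eq_and_eq hlink with ⟨h1, h2⟩ | ⟨h1, h2⟩
        · right; simp [h1, h2, hvv]
        · left; simp [h1, h2, hvv]
      · intro e he
        obtain ⟨v, hv, hvr, rfl⟩ := hDc e he
        have hv1 : v ≠ v₀ := fun h => hv₀ (h ▸ hv)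
        have hv2 : p v ≠ v₀ := fun h => hv₀ (h ▸ hpX v hv hvr)
        rcases (isLink_tail_head G (pe v)).eq_and_eq_or_eq_and_eq (hp v hv).1 with
          ⟨h1, h2⟩ | ⟨h1, h2⟩ <;> simp [h1, h2, hv1, hv2]
      · intro x hx
        have hXV : ∀ v ∈ X, v ∈ V(G) := fun v hv => by rw [hV]; exact Or.inr hv
        have hroot : ∀ k, ∀ v (hv : v ∈ X), dep v ≤ k → x ⟨v, hXV v hv⟩ = x ⟨r, hXV r hr⟩ := by
          intro k
          induction k with
          | zero =>
            intro v hv hk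
            have := (hp v hv).2
            omega
          | succ k ih =>
            intro v hv hk
            by_cases hvr : v = r
            · subst hvr; rfl
            · have h1 := (hp v hv).2
              rw [← ih (p v) (hpX v hv hvr) (by omega)]
              have h2 := hx (pe v) (fun h => Finset.mem_compl.1 h ((hmT _).2 ⟨v, hv, hvr, rfl⟩))
              rcases (isLink_tail_head G (pe v)).eq_and_eq_or_eq_and_eq (hp v hv).1 with
                ⟨h3, h4⟩ | ⟨h3, h4⟩
              · simpa only [h3, h4] using h2
              · simpa only [h3, h4] using h2.symm
        intro i j hi hj
        exact (hroot _ i (hmem i hi) le_rfl).trans (hroot _ j (hmem j hj) le_rfl).symm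
    have hℓ : IsMetric G (collapsedLength D ε) := by
      intro e
      unfold collapsedLength
      split_ifs
      · exact one_pos
      · exact hε0
    have hℓ1 : ∀ e, collapsedLength D ε e ≤ 1 := by
      intro e
      unfold collapsedLength
      split_ifs
      · exact le_rfl
      · exact hε1
    obtain ⟨μ, hμ, hμc⟩ := hc _ hℓ
    obtain ⟨s, hs, hsμ, f, hf0, hf⟩ := exists_solves_of_isNthEigenvalue_one hconn hℓ hμ
    have hlt : s₁ < s := by
      by_contra! hle
      -- All lengths are at most `1` and `s < π`, so no subdivision is needed.
      obtain ⟨x, hx, hxf⟩ := exists_vertex_ker_of_solves hs hℓ (fun e => by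
        have := hℓ1 e
        nlinarith) hf
      exact hf0 (hxf (hε s hs hle x hx))
    have hL : (D.card : ℝ) ≤ length G (collapsedLength D ε) := by
      calc (D.card : ℝ) = ∑ e ∈ D, collapsedLength D ε e := by
            rw [Finset.card_eq_sum_ones, Nat.cast_sum]
            exact Finset.sum_congr rfl fun e he => by rw [collapsedLength, if_pos he, Nat.cast_one]
        _ ≤ _ := Finset.sum_le_univ_sum_of_nonneg fun e => (hℓ e).le
    have hLpos : 0 < length G (collapsedLength D ε) := hd.trans_le hL
    have h1 : s₁ ^ 2 ≤ c / length G (collapsedLength D ε) ^ 2 := by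
      refine le_trans ?_ (hsμ.trans hμc)
      gcongr
    rw [le_div_iff₀ (by positivity)] at h1
    refine le_trans ?_ h1
    gcongr
  by_contra! hlt
  have hc0 : 0 ≤ c := by simpa using key 0 le_rfl pi_pos
  have h1 : √c < D.card * π := by
    rw [sqrt_lt' (mul_pos hd pi_pos), mul_pow]
    exact hlt
  -- The bound holds for every `s₁ < π`; one close enough to `π` contradicts `√c < D.card * π`.
  obtain ⟨s₁, h2, h3⟩ := exists_between ((div_lt_iff₀ hd).2 (by rwa [mul_comm] at h1))
  have h4 : 0 < s₁ := (by positivity : 0 ≤ √c / D.card).trans_lt h2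
  have h5 := key s₁ h4.le h3
  rw [div_lt_iff₀ hd, sqrt_lt' (mul_pos h4 hd), mul_pow] at h2
  linarith

end

end QuantumGraph

end

theorem theorem1p3 {α : Type*} {β : Type*} (G : Graph α β) [Finite V(G)] [Fintype E(G)]
    (hconn : QuantumGraph.Connected G) (hedge : E(G).Nonempty)
    (hloop : ∀ e x, ¬ G.IsLoopAt e x)
    (hpend : ∀ x, ¬ QuantumGraph.IsPendant G x)
    (htree : ∃ X : Set α, X ⊆ V(G) ∧ X.ncard + 1 = V(G).ncard ∧
      QuantumGraph.IsTree (G.induce X)) :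
    QuantumGraph.IsBigLambda G 1 ((1 + (QuantumGraph.bettiNumber G : ℝ)) ^ 2 * Real.pi ^ 2) := by
  obtain ⟨X, hXV, hcard, hX⟩ := htree
  have hfin : V(G).Finite := Set.toFinite _
  obtain ⟨v₀, hv₀⟩ : ∃ v₀, V(G) \ X = {v₀} := by
    rw [← Set.ncard_eq_one, Set.ncard_sdiff hXV (hfin.subset hXV)]
    omega
  have hv₀X : v₀ ∉ X := (hv₀ ▸ Set.mem_singleton v₀ : v₀ ∈ V(G) \ X).2
  have hV : V(G) = insert v₀ X := by
    rw [Set.insert_eq, ← hv₀, Set.sdiff_union_of_subset hXV]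
  refine ⟨fun ℓ hℓ => ?_, fun c hc => ?_⟩
  · exact QuantumGraph.exists_isNthEigenvalue_one_le hconn hedge hloop hpend hv₀X hV hX hℓ
  · exact QuantumGraph.le_of_forall_exists_isNthEigenvalue hconn hloop hv₀X hV hX hc
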